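/- **Setting.** Let $\mathcal W\subseteq\mathbb R^m$ be a measurable set and let $(W_t)_{t\ge 0}$ be a time-homogeneous Markov chain on $\mathcal W$ with transition kernel $P$; $\|\cdot\|$ is the Euclidean norm. Let $G:\mathcal W\times\mathbb R^{d_\lambda}\times\mathbb R^{d_\xi}\to\mathbb R^{d_\lambda}$ and $H:\mathcal W\times\mathbb R^{d_\xi}\to\mathbb R^{d_\xi}$ be measurable, let $\Pi_B$ be the projection onto the closed ball of radius $B$ centred at $0$, and let, for $t\ge0$, $$\lambda_{t+1}=\Pi_B\bigl(\lambda_t+\alpha_tG(W_t,\lambda_t,\xi_t)\bigr),\qquad \xi_{t+1}=\Pi_B\bigl(\xi_t+\beta_tH(W_t,\xi_t)\bigr),$$ with arbitrary initial values $\lambda_0,\xi_0$ known at time $0$, and step sizes $\alpha_t=\alpha_0t^{-\kappa}$, $\beta_t=\beta_0t^{-\delta}$ for $t\ge1$, where $\alpha_0,\beta_0>0$ are the step sizes at time $0$. **Assumption on the noise.** The chain is irreducible and aperiodic and has a unique stationary distribution $\nu$. With $U(w)=1+\|w\|^2$ there are a measurable set $\mathcal W_0\subseteq\mathcal W$, an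 integer $N\ge1$, a constant $b_1>0$ and a probability measure $\psi_0$ on $\mathcal W$ such that $P^N(w,A)\ge b_1\psi_0(A)$ for all $w\in\mathcal W_0$ and all measurable $A$, and there are constants $\rho\in[0,1)$, $b_2>0$ such that $$\mathbb E[U(W_1)\mid W_0=w]\le\rho\,U(w)+b_2\mathbf 1_{\mathcal W_0}(w)\quad\text{for all }w\in\mathcal W.$$ **Assumption on $G$, $H$.** Put $\bar G(\lambda,\xi)=\mathbb E_\nu[G(W,\lambda,\xi)]$ and $\bar H(\xi)=\mathbb E_\nu[H(W,\xi)]$. (a) $\bar H(\xi)=0$ has a unique solution $\xi^*$, and $\bar G(\lambda,\xi^*)=0$ has a unique solution $\lambda^*$. (b) $B>\max(\|\lambda^*\|,\|\xi^*\|)$, and there are $L>0$ and a positive function $h$ with $h(w)\le L(1+\|w\|)$ such that, for all $w\in\mathcal W$ and all $\lambda,\tilde\lambda,\xi,\tilde\xi$ of norm at most $B$: $\|G(w,\lambda,\xi)-G(w,\tilde\lambda,\tilde\xi)\|\le h(w)(\|\lambda-\tilde\lambda\|+\|\xi-\tilde\xi\|)$, $\|H(w,\xi)-H(w,\tilde\xi)\|\le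 h(w)\|\xi-\tilde\xi\|$, $\|G(w,\lambda,\xi)\|\le L(1+\|w\|)$ and $\|H(w,\xi)\|\le L(1+\|w\|)$. (c) There are $\zeta,\psi>0$ such that $(\lambda-\lambda^*)^\top(\bar G(\lambda,\xi^*)-\bar G(\lambda^*,\xi^*))\le-\zeta\|\lambda-\lambda^*\|^2$ and $(\xi-\xi^*)^\top(\bar H(\xi)-\bar H(\xi^*))\le-\psi\|\xi-\xi^*\|^2$ for all $\lambda\in\mathbb R^{d_\lambda}$, $\xi\in\mathbb R^{d_\xi}$. **Theorem.** Let $1/2<\kappa\le\delta<1$, $C>0$, $\kappa_c\in[0,\kappa-1/2)$, $\delta_c\in[0,\delta-1/2)$ and $w\in\mathcal W$. Put $b_\kappa=2\kappa-1-2\kappa_c$ and $b_\delta=2\delta-1-2\delta_c$. Then there are positive constants $C_\lambda$ and $C_\xi$, where (for given $P$, $G$, $H$, $B$, $\alpha_0$, $\beta_0$) $C_\lambda$ depends only on $(\delta,\kappa,\kappa_c,C,w)$ and $C_\xi$ only on $(\delta,\delta_c,C,w)$, such that for all sufficiently large integers $T$: (i) $\mathbb P\bigl(\|\lambda_t-\lambda^*\|\le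 Ct^{-\kappa_c}\ \ \forall t\ge T\mid W_0=w\bigr)\ge1-C_\lambda T^{-b_\kappa}\ln T$; (ii) $\mathbb P\bigl(\|\xi_t-\xi^*\|\le Ct^{-\delta_c}\ \ \forall t\ge T\mid W_0=w\bigr)\ge1-C_\xi T^{-b_\delta}\ln T$. Moreover, if the $W_t$ are i.i.d. (that is, $P(w',\cdot)=\nu$ for every $w'\in\mathcal W$), then the factor $\ln T$ can be removed from both bounds. -/

import Mathlib

open MeasureTheory ProbabilityTheory Filter Topology
open scoped ENNReal NNReal

namespace TwoTimescaleSA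

/-- Euclidean space of dimension `d`, with the `L²` norm. -/
abbrev Vec (d : ℕ) : Type := EuclideanSpace ℝ (Fin d)

/-- The metric projection of `ℝᵈ` onto the closed ball of radius `B` centred at the origin. -/
noncomputable def ballProj {d : ℕ} (B : ℝ) (x : Vec d) : Vec d :=
  if ‖x‖ ≤ B then x else (B / ‖x‖) • x

/-- Polynomial step sizes: `a₀` at time `0` and `a₀ t ^ (-p)` at times `t ≥ 1`. -/
noncomputable def stepSize (a₀ p : ℝ) (t : ℕ) : ℝ :=
  if t = 0 then a₀ else a₀ * (t : ℝ) ^ (-p)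

section Chain

variable {m : ℕ} {S : Set (Vec m)}

/-- A transition kernel is aperiodic if the state space contains no `d`-cycle with `d ≥ 2`:
there are no disjoint nonempty measurable sets `D 0, …, D (d - 1)` through which the chain
moves cyclically with probability one. (For an irreducible chain such a cycle automatically
carries all the mass of every irreducibility measure.) -/
def IsAperiodic (P : Kernel S S) : Prop :=
  ∀ k : ℕ, ¬ ∃ D : Fin (k + 2) → Set S,
    (∀ i, MeasurableSet (D i) ∧ (D i).Nonempty) ∧
    (∀ i j, i ≠ j → Disjoint (D i) (D j)) ∧
    ∀ i, ∀ w ∈ D i, P w (D (i + 1)) = 1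

/-- The Lyapunov function `U(w) = 1 + ‖w‖ ^ dU`. -/
noncomputable def lyapunov (dU : ℝ) (w : S) : ℝ := 1 + ‖(w : Vec m)‖ ^ dU

/-- The Markov chain with transition kernel `P` is irreducible and aperiodic, has `ν` as its
unique stationary distribution, and is geometrically ergodic with respect to
`U = 1 + ‖·‖ ^ dU`: a minorization condition holds on a set `W₀`, together with the geometric
drift condition towards the same `W₀`. -/
structure IsGeometricallyErgodic (P : Kernel S S) (ν : Measure S) (dU : ℝ) : Prop where
  irreducible : ∃ φ : Measure S, SigmaFinite φ ∧ φ ≠ 0 ∧ Kernel.IsIrreducible φ P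
  aperiodic : IsAperiodic P
  isProbabilityMeasure : IsProbabilityMeasure ν
  invariant : Kernel.Invariant P ν
  unique : ∀ ν' : Measure S, IsProbabilityMeasure ν' → Kernel.Invariant P ν' → ν' = ν
  minorization_drift : ∃ W₀ : Set S, MeasurableSet W₀ ∧
    (∃ N : ℕ, 0 < N ∧ ∃ b₁ : ℝ, 0 < b₁ ∧ ∃ ψ : Measure S, IsProbabilityMeasure ψ ∧
      ∀ w ∈ W₀, ∀ A : Set S, MeasurableSet A → ENNReal.ofReal b₁ * ψ A ≤ (P ^ N) w A) ∧
    (∃ ρ : ℝ, 0 ≤ ρ ∧ ρ < 1 ∧ ∃ b₂ : ℝ, 0 < b₂ ∧ ∀ w : S,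
      ∫⁻ y, ENNReal.ofReal (lyapunov dU y) ∂(P w) ≤
        ENNReal.ofReal (ρ * lyapunov dU w + W₀.indicator (fun _ => b₂) w))

/-- The chain is i.i.d.: whatever the current state, the next one has law `ν`. -/
def IsIID (P : Kernel S S) (ν : Measure S) : Prop := ∀ w, P w = ν

/-- The averaged field `Ḡ(lam, xi) = E_ν[G(W, lam, xi)]`. -/
noncomputable def meanG {dl dx : ℕ} (ν : Measure S) (G : S → Vec dl → Vec dx → Vec dl)
    (lam : Vec dl) (xi : Vec dx) : Vec dl := ∫ w, G w lam xi ∂ν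

/-- The averaged field `H̄(xi) = E_ν[H(W, xi)]`. -/
noncomputable def meanH {dx : ℕ} (ν : Measure S) (H : S → Vec dx → Vec dx)
    (xi : Vec dx) : Vec dx := ∫ w, H w xi ∂ν

/-- The regularity conditions on the update functions `G`, `H`, for the projection radius `B`
and the roots `lamStar`, `xiStar` of the averaged fields: uniqueness of the roots, Lipschitz
continuity and linear growth on the ball of radius `B`, and strong monotonicity. -/
structure IsRegularSystem {dl dx : ℕ} (ν : Measure S)
    (G : S → Vec dl → Vec dx → Vec dl) (H : S → Vec dx → Vec dx)
    (B : ℝ) (lamStar : Vec dl) (xiStar : Vec dx) : Prop where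
  root_H : ∀ xi, meanH ν H xi = 0 ↔ xi = xiStar
  root_G : ∀ lam, meanG ν G lam xiStar = 0 ↔ lam = lamStar
  radius : max ‖lamStar‖ ‖xiStar‖ < B
  lipschitz_growth : ∃ L : ℝ, 0 < L ∧
    (∃ h : S → ℝ, (∀ w, 0 < h w) ∧ (∀ w, h w ≤ L * (1 + ‖(w : Vec m)‖)) ∧
      (∀ w lam lam' xi xi', ‖lam‖ ≤ B → ‖lam'‖ ≤ B → ‖xi‖ ≤ B → ‖xi'‖ ≤ B →
        ‖G w lam xi - G w lam' xi'‖ ≤ h w * (‖lam - lam'‖ + ‖xi - xi'‖)) ∧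
      (∀ w xi xi', ‖xi‖ ≤ B → ‖xi'‖ ≤ B → ‖H w xi - H w xi'‖ ≤ h w * ‖xi - xi'‖)) ∧
    (∀ w lam xi, ‖lam‖ ≤ B → ‖xi‖ ≤ B → ‖G w lam xi‖ ≤ L * (1 + ‖(w : Vec m)‖)) ∧
    (∀ w xi, ‖xi‖ ≤ B → ‖H w xi‖ ≤ L * (1 + ‖(w : Vec m)‖))
  monotone_G : ∃ ζ : ℝ, 0 < ζ ∧ ∀ lam,
    inner ℝ (lam - lamStar) (meanG ν G lam xiStar - meanG ν G lamStar xiStar) ≤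
      -ζ * ‖lam - lamStar‖ ^ 2
  monotone_H : ∃ ψ : ℝ, 0 < ψ ∧ ∀ xi,
    inner ℝ (xi - xiStar) (meanH ν H xi - meanH ν H xiStar) ≤ -ψ * ‖xi - xiStar‖ ^ 2

section Trajectory

variable {Ω : Type*} [mΩ : MeasurableSpace Ω]

/-- `W` is a Markov chain with transition kernel `P`, with respect to the filtration `ℱ`,
started at the point `w`. Thus `μ` plays the role of the conditional law given `W 0 = w`. -/
structure IsMarkovChainFrom (P : Kernel S S) (w : S) (μ : Measure Ω) (ℱ : Filtration ℕ mΩ)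
    (W : ℕ → Ω → S) : Prop where
  adapted : ∀ t, Measurable[ℱ t] (W t)
  initial : ∀ᵐ ω ∂μ, W 0 ω = w
  markov : ∀ t, ∀ A : Set S, MeasurableSet A →
    μ[(W (t + 1) ⁻¹' A).indicator (fun _ => (1 : ℝ)) | ℱ t] =ᵐ[μ] fun ω => (P (W t ω)).real A

/-- `(lam, xi)` are the iterates of projected two-timescale stochastic approximation driven
by `W`, with step sizes `a` and `b` and projection radius `B`; the initial values are
arbitrary vectors known at time `0`. -/
structure IsTwoTimescale {dl dx : ℕ}
    (G : S → Vec dl → Vec dx → Vec dl) (H : S → Vec dx → Vec dx) (B : ℝ) (a b : ℕ → ℝ)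
    (ℱ : Filtration ℕ mΩ) (W : ℕ → Ω → S) (lam : ℕ → Ω → Vec dl) (xi : ℕ → Ω → Vec dx) :
    Prop where
  lam_zero : Measurable[ℱ 0] (lam 0)
  xi_zero : Measurable[ℱ 0] (xi 0)
  lam_succ : ∀ t ω,
    lam (t + 1) ω = ballProj B (lam t ω + a t • G (W t ω) (lam t ω) (xi t ω))
  xi_succ : ∀ t ω, xi (t + 1) ω = ballProj B (xi t ω + b t • H (W t ω) (xi t ω))

end Trajectory

end Chain

end TwoTimescaleSA

set_option linter.unusedSectionVars false

/-! Without noise, strong monotonicity would make `‖x_t - x₀‖²` contract by a factor `1 - const *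
a_t`, up to `O(a_t²)`. Markov noise is not a martingale difference, so it does not vanish on
conditioning. The remedy is the Poisson equation `g - P g = f - ν f` for `f = ⟪x - x₀, F · x p⟫`.
Adding `2 a_t g(x_t, p_t, W_t)` to the squared distance turns the noise into the martingale
difference `2 a_t (g(x_t, p_t, W_{t+1}) - P g(x_t, p_t, W_t))`. What remains comes from the change
of `a_t`, `x_t`, `p_t` in one step; `g` is Lipschitz in its parameters, so this is `O(a_t²)`
(`perturbed_step`, `exists_lyapunovProcess`). The error of the parameter `p` enters only as `a_t
‖p_t - p₀‖²`.

The Poisson equation is solved in a weighted supremum norm. Drift and minorization give Harris'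
contraction for a Cesàro mean of powers of `P` (`exists_contraction`). Its Neumann series solves the
equation for the mean, and a telescoping identity transfers the solution to `P`
(`HasDrift.exists_poissonSolver`). The weight is `V = √U`: the fields and `g` grow like `V`, so the
quadratic errors grow like `U`, whose expectation along the chain stays bounded.

For the two timescales, let `Z` and `Y` be the Lyapunov processes of `lam` and `xi`. In `D_t =
t^(2κc) Z_t + A t^(2κc + δ - κ) Y_t` the coupling term and the contraction of `Y` carry the same
power of `t`, so a large `A` absorbs the coupling (`combined_step`). The result is a contraction by
`1 - 2/t` with error `O(t^(-1-b))`, where `b = 2κ - 1 - 2κc`. Hence `E D_T = O(T^(-b))`, and a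
maximal inequality bounds the probability of ever exceeding a level after `T` (`exists_tail_bound`).
For `xi` alone the same argument runs with `Y = 0`.

No mixing time enters, so this gives the bound without the logarithm for the Markov chain itself;
both forms in the theorem follow from it. -/

namespace TwoTimescaleSA

/-! ### Weighted bounds, iterated drift and Cesàro kernels -/

section Harris

variable {X : Type*} [MeasurableSpace X]

/-- Geometric drift of `V` towards the set `W₀` under the kernel `P`. -/
structure HasDrift (P : Kernel X X) (V : X → ℝ) (W₀ : Set X) (ρ b : ℝ) : Prop where
  measurable : Measurable V
  one_le : ∀ x, 1 ≤ V x
  measurableSet : MeasurableSet W₀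
  rho_nonneg : 0 ≤ ρ
  rho_lt : ρ < 1
  b_pos : 0 < b
  integrable : ∀ x, Integrable V (P x)
  le : ∀ x, ∫ y, V y ∂(P x) ≤ ρ * V x + W₀.indicator (fun _ => b) x

/-- `f` is measurable and bounded by `s` in the norm weighted by `V`. -/
structure WBound (V : X → ℝ) (s : ℝ) (f : X → ℝ) : Prop where
  measurable : Measurable f
  bound : ∀ x, |f x| ≤ s * V x

lemma WBound.integrable {V f : X → ℝ} {s : ℝ} (hf : WBound V s f) {μ : Measure X}
    (hV : Integrable V μ) : Integrable f μ :=
  (hV.const_mul s).mono' hf.measurable.aestronglyMeasurable (ae_of_all _ hf.bound)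

lemma WBound.abs_integral_le {V f : X → ℝ} {s : ℝ} (hf : WBound V s f) {μ : Measure X}
    (hV : Integrable V μ) : |∫ x, f x ∂μ| ≤ s * ∫ x, V x ∂μ := by
  rw [← integral_const_mul]
  exact (abs_integral_le_integral_abs).trans
    (integral_mono (hf.integrable hV).abs (hV.const_mul s) hf.bound)

lemma WBound.sub {V f g : X → ℝ} {s r : ℝ} (hf : WBound V s f) (hg : WBound V r g) :
    WBound V (s + r) (fun x => f x - g x) :=
  ⟨hf.measurable.sub hg.measurable, fun x => by
    have := abs_sub (f x) (g x)
    linarith [hf.bound x, hg.bound x]⟩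

lemma WBound.integral_kernel {P : Kernel X X} [IsMarkovKernel P] {V f : X → ℝ} {s c : ℝ}
    (hf : WBound V s f) (hs : 0 ≤ s)
    (hV : ∀ x, Integrable V (P x)) (hle : ∀ x, ∫ y, V y ∂(P x) ≤ c * V x) :
    WBound V (s * c) (fun x => ∫ y, f y ∂(P x)) :=
  ⟨(hf.measurable.stronglyMeasurable.integral_kernel).measurable, fun x =>
    (hf.abs_integral_le (hV x)).trans (by
      rw [mul_assoc]; exact mul_le_mul_of_nonneg_left (hle x) hs)⟩

section Powers

variable {P : Kernel X X} [IsMarkovKernel P] {V : X → ℝ} {W₀ : Set X} {ρ b : ℝ}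

instance isMarkovKernel_pow (k : ℕ) : IsMarkovKernel (P ^ k) := by
  induction k with
  | zero => rw [pow_zero]; exact inferInstanceAs (IsMarkovKernel Kernel.id)
  | succ k ih => rw [Kernel.pow_add]; rw [pow_one]; infer_instance

lemma pow_succ_eq_comp (P : Kernel X X) (k : ℕ) : P ^ (k + 1) = P ∘ₖ (P ^ k) := by
  rw [add_comm, Kernel.pow_add, pow_one]

namespace HasDrift

lemma integrable_pow (h : HasDrift P V W₀ ρ b) (k : ℕ) (x : X) : Integrable V ((P ^ k) x) := by
  induction k with
  | zero =>
    have : (P ^ 0) x = Measure.dirac x := by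
      rw [pow_zero]; exact Kernel.id_apply x
    rw [this]
    exact integrable_dirac' h.measurable.stronglyMeasurable (by simp)
  | succ k ih =>
    have hk := pow_succ_eq_comp P k
    rw [hk, integrable_comp_iff h.measurable.aestronglyMeasurable]
    refine ⟨ae_of_all _ h.integrable, ?_⟩
    have hn : ∀ y, ‖V y‖ = V y := fun y =>
      Real.norm_of_nonneg (zero_le_one.trans (h.one_le y))
    simp only [hn]
    refine ((ih.const_mul ρ).add (integrable_const b)).mono'
      h.measurable.stronglyMeasurable.integral_kernel.aestronglyMeasurable (ae_of_all _ fun y => ?_)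
    rw [Real.norm_of_nonneg (integral_nonneg fun z => zero_le_one.trans (h.one_le z))]
    refine (h.le y).trans ?_
    have : W₀.indicator (fun _ => b) y ≤ b := Set.indicator_le_self' (fun _ _ => h.b_pos.le) y
    simpa using this

lemma integral_pow_succ_le (h : HasDrift P V W₀ ρ b) (k : ℕ) (x : X) :
    ∫ y, V y ∂((P ^ (k + 1)) x) ≤ ρ * ∫ y, V y ∂((P ^ k) x) + b * ((P ^ k) x).real W₀ := by
  have hk := pow_succ_eq_comp P k
  have hi := h.integrable_pow (k + 1) x
  rw [hk] at hi ⊢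
  rw [Kernel.integral_comp hi]
  have hind : Integrable (W₀.indicator (fun _ => b)) ((P ^ k) x) :=
    (integrable_const b).indicator h.measurableSet
  calc ∫ y, ∫ z, V z ∂(P y) ∂((P ^ k) x)
      ≤ ∫ y, (ρ * V y + W₀.indicator (fun _ => b) y) ∂((P ^ k) x) :=
        integral_mono hi.integral_comp (((h.integrable_pow k x).const_mul ρ).add hind) h.le
    _ = _ := by
        rw [integral_add ((h.integrable_pow k x).const_mul ρ) hind, integral_const_mul,
          integral_indicator_const _ h.measurableSet, smul_eq_mul, mul_comm b]

lemma integral_pow_zero (h : HasDrift P V W₀ ρ b) (x : X) : ∫ y, V y ∂((P ^ 0) x) = V x := by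
  have : (P ^ 0) x = Measure.dirac x := by
    rw [pow_zero]; exact Kernel.id_apply x
  rw [this, integral_dirac' _ _ h.measurable.stronglyMeasurable]

/-- The constant `b / (1 - ρ)` is the fixed point of `y ↦ ρ y + b`. -/
lemma integral_pow_le (h : HasDrift P V W₀ ρ b) (k : ℕ) (x : X) :
    ∫ y, V y ∂((P ^ k) x) ≤ ρ ^ k * V x + b / (1 - ρ) := by
  have hρ : 0 < 1 - ρ := sub_pos.2 h.rho_lt
  induction k with
  | zero =>
    rw [h.integral_pow_zero]
    have := div_nonneg h.b_pos.le hρ.le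
    simp [this]
  | succ k ih =>
    have h1 := h.integral_pow_succ_le k x
    have h2 : ((P ^ k) x).real W₀ ≤ 1 := measureReal_le_one
    have h3 := mul_le_mul_of_nonneg_left ih h.rho_nonneg
    have h4 := mul_le_mul_of_nonneg_left h2 h.b_pos.le
    have h5 : ρ * (b / (1 - ρ)) + b = b / (1 - ρ) := by field_simp; ring
    rw [pow_succ ρ]
    nlinarith

/-- Outside `W₀` the mean of `V` decays geometrically, yet it never falls below `1`; only visits to
`W₀` can make up the difference. This lower bound on the expected number of visits is what spreads
the minorization from `W₀` to sublevel sets. -/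
lemma one_sub_le_sum_visits (h : HasDrift P V W₀ ρ b) (n : ℕ) (x : X) :
    1 - ρ ^ n * V x ≤ b * ∑ j ∈ Finset.range n, ((P ^ j) x).real W₀ := by
  have key : ∫ y, V y ∂((P ^ n) x) ≤
      ρ ^ n * V x + b * ∑ j ∈ Finset.range n, ((P ^ j) x).real W₀ := by
    induction n with
    | zero => rw [h.integral_pow_zero]; simp
    | succ n ih =>
      have h1 := h.integral_pow_succ_le n x
      have h3 := mul_le_mul_of_nonneg_left ih h.rho_nonneg
      have h4 : 0 ≤ b * ∑ j ∈ Finset.range n, ((P ^ j) x).real W₀ :=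
        mul_nonneg h.b_pos.le (Finset.sum_nonneg fun _ _ => measureReal_nonneg)
      rw [Finset.sum_range_succ, pow_succ ρ, mul_add]
      nlinarith [h.rho_lt, mul_nonneg (sub_nonneg.2 h.rho_lt.le) h4]
  have h1 : (1 : ℝ) ≤ ∫ y, V y ∂((P ^ n) x) := by
    have := integral_mono (integrable_const (1 : ℝ)) (h.integrable_pow n x) h.one_le
    simpa using this
  linarith

end HasDrift

end Powers

/-- The kernel `(M + 1)⁻¹ ∑_{k ≤ M} P ^ k`. -/
noncomputable def cesaro (P : Kernel X X) (M : ℕ) : Kernel X X where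
  toFun x := ((M : ℝ≥0∞) + 1)⁻¹ • ∑ k ∈ Finset.range (M + 1), (P ^ k) x
  measurable' := by
    refine Measure.measurable_of_measurable_coe _ fun s hs => ?_
    simp only [Measure.smul_apply, Measure.finsetSum_apply, smul_eq_mul]
    exact (Finset.measurable_sum _ fun k _ => (P ^ k).measurable_coe hs).const_mul _

lemma cesaro_apply (P : Kernel X X) (M : ℕ) (x : X) :
    cesaro P M x = ((M : ℝ≥0∞) + 1)⁻¹ • ∑ k ∈ Finset.range (M + 1), (P ^ k) x := rfl

instance (P : Kernel X X) [IsMarkovKernel P] (M : ℕ) : IsMarkovKernel (cesaro P M) := ⟨fun x => ⟨by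
  rw [cesaro_apply]
  simp only [Measure.smul_apply, Measure.finsetSum_apply, measure_univ, Finset.sum_const,
    Finset.card_range, nsmul_eq_mul, mul_one, smul_eq_mul, Nat.cast_add, Nat.cast_one]
  exact ENNReal.inv_mul_cancel (by simp) (by finiteness)⟩⟩

lemma integrable_cesaro {P : Kernel X X} {M : ℕ} {x : X} {f : X → ℝ}
    (hf : ∀ k, Integrable f ((P ^ k) x)) : Integrable f (cesaro P M x) := by
  rw [cesaro_apply]
  refine Integrable.smul_measure ?_ (by simp)
  exact integrable_finsetSum_measure.2 fun k _ => hf k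

lemma integral_cesaro {P : Kernel X X} {M : ℕ} {x : X} {f : X → ℝ}
    (hf : ∀ k, Integrable f ((P ^ k) x)) :
    ∫ y, f y ∂(cesaro P M x) =
      ((M : ℝ) + 1)⁻¹ * ∑ k ∈ Finset.range (M + 1), ∫ y, f y ∂((P ^ k) x) := by
  rw [cesaro_apply, integral_smul_measure, integral_finsetSum_measure fun k _ => hf k,
    smul_eq_mul, ENNReal.toReal_inv]
  norm_cast

end Harris

/-! ### Harris' theorem: contraction of a weighted oscillation -/

section Harris

variable {X : Type*} [MeasurableSpace X]

/-- Action of a kernel on real functions. -/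
noncomputable def avg (K : Kernel X X) (f : X → ℝ) (x : X) : ℝ := ∫ y, f y ∂(K x)

/-- A function whose oscillation is dominated by `v x + v y` is, up to a constant, dominated
by `v`. -/
lemma exists_const_abs_sub_le {X : Type*} {f v : X → ℝ} (h : ∀ x y, f x - f y ≤ v x + v y) :
    ∃ c, ∀ x, |f x - c| ≤ v x := by
  rcases isEmpty_or_nonempty X with hX | hX
  · exact ⟨0, fun x => (hX.false x).elim⟩
  obtain ⟨x₀⟩ := hX
  have hbdd : BddAbove (Set.range fun x => f x - v x) :=
    ⟨f x₀ + v x₀, by rintro _ ⟨x, rfl⟩; have := h x x₀; dsimp only; linarith⟩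
  have : Nonempty X := ⟨x₀⟩
  -- The hypothesis says that every `f x - v x` lies below every `f y + v y`; any number separating
  -- the two families serves as the constant.
  refine ⟨⨆ x, (f x - v x), fun x => abs_le.2 ⟨?_, ?_⟩⟩
  · have : ⨆ y, (f y - v y) ≤ f x + v x := ciSup_le fun y => by have := h y x; linarith
    linarith
  · have := le_ciSup hbdd x
    linarith

/-- **Harris' theorem**: a kernel with a geometric drift that is minorized on a large sublevel
set of the Lyapunov function contracts a weighted oscillation seminorm. -/
theorem exists_contraction {K : Kernel X X} [IsMarkovKernel K] {V : X → ℝ} {γ c R ε : ℝ}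
    {ψ : Measure X} [IsProbabilityMeasure ψ]
    (hV : ∀ x, 1 ≤ V x) (hKV : ∀ x, Integrable V (K x))
    (hγ1 : γ < 1) (hc : 0 ≤ c)
    (hdrift : ∀ x, ∫ y, V y ∂(K x) ≤ γ * V x + c)
    (hR : 2 * c < (1 - γ) * R) (hε : 0 < ε) (hε1 : ε ≤ 1)
    (hmin : ∀ x, V x ≤ R → ∀ A, MeasurableSet A → ENNReal.ofReal ε * ψ A ≤ K x A) :
    ∃ β α : ℝ, 0 < β ∧ 0 ≤ α ∧ α < 1 ∧ ∀ (f : X → ℝ) (s : ℝ), Measurable f → 0 ≤ s →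
      (∀ x y, f x - f y ≤ s * (2 + β * (V x + V y))) →
      ∀ x y, avg K f x - avg K f y ≤ α * s * (2 + β * (V x + V y)) := by
  have hR0 : 0 < R := by
    by_contra hneg
    nlinarith [mul_nonneg (sub_nonneg.2 hγ1.le) (sub_nonneg.2 (not_lt.1 hneg))]
  -- Chosen so that the additive drift term costs `2 β c ≤ ε`, half of the `2 ε` that the
  -- minorization gains.
  set β : ℝ := ε / (2 * (c + 1)) with hβdef
  have hβ : 0 < β := by positivity
  have hβc : β * c ≤ ε / 2 := by
    rw [hβdef, div_mul_eq_mul_div, div_le_iff₀ (by positivity)]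
    nlinarith
  -- The contraction that the drift alone yields when `V x + V y = R`; for larger sums it persists
  -- because `τ₁ ≤ 1 - γ`.
  set τ₁ : ℝ := β * ((1 - γ) * R - 2 * c) / (2 + β * R) with hτ₁def
  have hden : 0 < 2 + β * R := by positivity
  have hτ₁ : 0 < τ₁ := div_pos (mul_pos hβ (sub_pos.2 hR)) hden
  have hτ₁mul : τ₁ * (2 + β * R) = β * ((1 - γ) * R - 2 * c) := div_mul_cancel₀ _ hden.ne'
  set τ : ℝ := min τ₁ (ε / 2) with hτdef
  have hτ : 0 < τ := lt_min hτ₁ (by positivity)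
  have hτle1 : τ ≤ τ₁ := min_le_left _ _
  have hτle2 : τ ≤ ε / 2 := min_le_right _ _
  have hτγ : τ₁ ≤ 1 - γ := by
    rw [hτ₁def, div_le_iff₀ hden]
    nlinarith [mul_nonneg hβ.le hc]
  refine ⟨β, 1 - τ, hβ, by linarith, by linarith, fun f s hf hs hosc x y => ?_⟩
  obtain ⟨c₀, hc₀⟩ := exists_const_abs_sub_le (f := f) (v := fun x => s * (1 + β * V x))
    (fun x y => (hosc x y).trans (le_of_eq (by ring)))
  set v : X → ℝ := fun x => s * (1 + β * V x) with hvdef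
  have hv : ∀ z, Integrable v (K z) := fun z =>
    ((integrable_const 1).add ((hKV z).const_mul β)).const_mul s
  set g : X → ℝ := fun x => f x - c₀ with hgdef
  have hgm : Measurable g := hf.sub_const _
  have hg : ∀ z, Integrable g (K z) := fun z =>
    (hv z).mono' hgm.aestronglyMeasurable (ae_of_all _ hc₀)
  have hfint : ∀ z, Integrable f (K z) := fun z =>
    ((hg z).add (integrable_const c₀)).congr (ae_of_all _ fun a => by simp [hgdef])
  have havg : ∀ z, avg K f z = avg K g z + c₀ := fun z => by
    simp only [avg, hgdef]
    rw [integral_sub (hfint z) (integrable_const _)]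
    simp
  have hvle : ∀ z, avg K v z ≤ s * (1 + β * (γ * V z + c)) := fun z => by
    simp only [avg, hvdef]
    rw [integral_const_mul, integral_add (integrable_const _) ((hKV z).const_mul β),
      integral_const_mul]
    have := mul_le_mul_of_nonneg_left (hdrift z) hβ.le
    refine mul_le_mul_of_nonneg_left ?_ hs
    simpa using this
  have hdiff : avg K f x - avg K f y = avg K g x - avg K g y := by rw [havg, havg]; ring
  rw [hdiff]
  have hVx := hV x
  have hVy := hV y
  -- Far out, the drift decreases the weight. Otherwise both points lie in the minorized set, where
  -- the two transition laws share the mass `ε ψ`.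
  rcases le_total R (V x + V y) with hlarge | hsmall
  · have h1 : avg K g x ≤ avg K v x :=
      integral_mono (hg x) (hv x) fun z => (le_abs_self _).trans (hc₀ z)
    have h2 : -avg K g y ≤ avg K v y := by
      rw [avg, ← integral_neg]
      exact integral_mono (hg y).neg (hv y) fun z => (neg_le_abs _).trans (hc₀ z)
    have h3 : 2 + β * γ * (V x + V y) + 2 * β * c ≤ (1 - τ) * (2 + β * (V x + V y)) := by
      have e1 : τ * (2 + β * R) ≤ β * ((1 - γ) * R - 2 * c) :=
        (mul_le_mul_of_nonneg_right hτle1 hden.le).trans hτ₁mul.le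
      have e2 : 0 ≤ (1 - γ - τ) * (β * (V x + V y - R)) :=
        mul_nonneg (by linarith) (mul_nonneg hβ.le (by linarith))
      nlinarith
    have := mul_le_mul_of_nonneg_left h3 hs
    nlinarith [hvle x, hvle y]
  · have hle : ∀ z, V z ≤ R → ENNReal.ofReal ε • ψ ≤ K z := fun z hz =>
      Measure.le_iff.2 fun A hA => by simpa using hmin z hz A hA
    have hxR : V x ≤ R := by linarith
    have hyR : V y ≤ R := by linarith
    have hψ : ∀ {u : X → ℝ}, Integrable u (K x) → Integrable u ψ := fun {u} hu =>
      (integrable_smul_measure (by simpa using hε) ENNReal.ofReal_ne_top).1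
        (hu.mono_measure (hle x hxR))
    have hlow : ∀ {u : X → ℝ} {z : X}, V z ≤ R → Integrable u (K z) → (∀ a, 0 ≤ u a) →
        ε * ∫ a, u a ∂ψ ≤ avg K u z := fun {u z} hz hu hu0 => by
      have := integral_mono_measure (hle z hz) (ae_of_all _ hu0) hu
      rwa [integral_smul_measure, ENNReal.toReal_ofReal hε.le, smul_eq_mul] at this
    -- Since `|g| ≤ v`, both `v - g` and `v + g` are nonnegative and may be integrated against the
    -- common part. In the sum the `g` terms cancel and `2 ε ∫ v ∂ψ ≥ 2 ε s` is gained.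
    have h1 := hlow hxR ((hv x).sub (hg x)) fun a =>
      sub_nonneg.2 ((le_abs_self _).trans (hc₀ a))
    have h2 := hlow hyR ((hv y).add (hg y)) fun a => by
      have := (neg_le_abs _).trans (hc₀ a)
      simp only [Pi.add_apply, hgdef]; linarith
    simp only [avg, Pi.sub_apply, Pi.add_apply] at h1 h2
    rw [integral_sub (hψ (hv x)) (hψ (hg x)), integral_sub (hv x) (hg x)] at h1
    rw [integral_add (hψ (hv x)) (hψ (hg x)), integral_add (hv y) (hg y)] at h2
    have h3 : s ≤ ∫ a, v a ∂ψ := by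
      have := integral_mono (integrable_const s) (hψ (hv x)) fun a => by
        have : 0 ≤ s * (β * V a) :=
          mul_nonneg hs (mul_nonneg hβ.le (zero_le_one.trans (hV a)))
        simp only [hvdef]; linarith
      simpa using this
    have h4 := mul_le_mul_of_nonneg_left h3 hε.le
    have h5 : 2 + β * γ * (V x + V y) + 2 * β * c - 2 * ε ≤
        (1 - τ) * (2 + β * (V x + V y)) := by
      have e2 : 0 ≤ (1 - γ - τ) * (β * (V x + V y)) :=
        mul_nonneg (by linarith) (mul_nonneg hβ.le (by linarith))
      nlinarith
    have h6 := mul_le_mul_of_nonneg_left h5 hs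
    have h7 := hvle x
    have h8 := hvle y
    simp only [avg] at h7 h8 ⊢
    nlinarith

end Harris

/-! ### Drift and minorization of Cesàro means; stationary moments -/

section Harris

variable {X : Type*} [MeasurableSpace X]

section CesaroDrift

variable {P : Kernel X X} [IsMarkovKernel P] {V : X → ℝ} {W₀ : Set X} {ρ b : ℝ}

lemma HasDrift.integral_cesaro_le (h : HasDrift P V W₀ ρ b) {M : ℕ} (hM : 1 ≤ M) (x : X) :
    ∫ y, V y ∂(cesaro P M x) ≤ (1 + ρ) / 2 * V x + b / (1 - ρ) := by
  have hρ := h.rho_nonneg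
  have hρ1 := h.rho_lt
  have hVx : 0 ≤ V x := zero_le_one.trans (h.one_le x)
  have hM' : (1 : ℝ) ≤ M := by exact_mod_cast hM
  rw [integral_cesaro fun k => h.integrable_pow k x, inv_mul_le_iff₀ (by positivity)]
  rw [Finset.sum_range_succ']
  have h0 : ∫ y, V y ∂((P ^ 0) x) = V x := h.integral_pow_zero x
  have h1 : ∑ k ∈ Finset.range M, ∫ y, V y ∂((P ^ (k + 1)) x) ≤
      ∑ k ∈ Finset.range M, (ρ * V x + b / (1 - ρ)) := by
    refine Finset.sum_le_sum fun k _ => (h.integral_pow_le (k + 1) x).trans ?_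
    have : ρ ^ (k + 1) ≤ ρ := by
      simpa using pow_le_pow_of_le_one hρ hρ1.le (Nat.succ_le_succ (Nat.zero_le k))
    have := mul_le_mul_of_nonneg_right this hVx
    linarith
  rw [Finset.sum_const, Finset.card_range, nsmul_eq_mul] at h1
  rw [h0]
  have h2 : 0 ≤ b / (1 - ρ) := div_nonneg h.b_pos.le (by linarith)
  have h3 : 0 ≤ (M - 1) * ((1 - ρ) * V x) :=
    mul_nonneg (by linarith) (mul_nonneg (by linarith) hVx)
  nlinarith

/-- From a point with `V ≤ R` the chain visits `W₀` in expectation at least `1 / (2 b)` times before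
a time `n` uniform in the point, and each visit is followed `N` steps later by a copy of `b₁ ψ`.
Averaging over times collects these contributions whatever the times of the visits, so periodicity
is harmless. -/
lemma HasDrift.exists_cesaro_minorization (h : HasDrift P V W₀ ρ b) {N : ℕ} {b₁ : ℝ}
    (hb₁ : 0 < b₁) {ψ : Measure X}
    (hmin : ∀ x ∈ W₀, ∀ A : Set X, MeasurableSet A → ENNReal.ofReal b₁ * ψ A ≤ (P ^ N) x A)
    (R : ℝ) :
    ∃ M : ℕ, 1 ≤ M ∧ ∃ ε : ℝ, 0 < ε ∧ ε ≤ 1 ∧ ∀ x, V x ≤ R → ∀ A, MeasurableSet A →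
      ENNReal.ofReal ε * ψ A ≤ cesaro P M x A := by
  have hb := h.b_pos
  obtain ⟨n, hn⟩ : ∃ n : ℕ, ρ ^ n * max R 1 < 1 / 2 := by
    obtain ⟨n, hn⟩ := exists_pow_lt_of_lt_one (x := 1 / 2 / max R 1) (by positivity) h.rho_lt
    exact ⟨n, by rwa [lt_div_iff₀ (by positivity)] at hn⟩
  -- The mean runs over `n + N + 2` powers, enough to contain all exponents `j + N` with `j < n`.
  -- The minimum with `1` serves the condition `ε ≤ 1` of Harris' theorem.
  refine ⟨n + N + 1, by omega, min (b₁ * (1 / (2 * b)) / (n + N + 2)) 1,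
    lt_min (by positivity) one_pos, min_le_right _ _, fun x hx A hA => ?_⟩
  have hvis : 1 / (2 * b) ≤ ∑ j ∈ Finset.range n, ((P ^ j) x).real W₀ := by
    have h1 := h.one_sub_le_sum_visits n x
    have h2 : ρ ^ n * V x ≤ ρ ^ n * max R 1 :=
      mul_le_mul_of_nonneg_left (hx.trans (le_max_left _ _)) (pow_nonneg h.rho_nonneg n)
    rw [div_le_iff₀ (by positivity)]
    nlinarith
  have hvis' : ENNReal.ofReal (1 / (2 * b)) ≤ ∑ j ∈ Finset.range n, (P ^ j) x W₀ := by
    refine (ENNReal.ofReal_le_ofReal hvis).trans (le_of_eq ?_)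
    rw [ENNReal.ofReal_sum_of_nonneg fun _ _ => measureReal_nonneg]
    exact Finset.sum_congr rfl fun j _ => ofReal_measureReal
  have hstep : ∀ j, ENNReal.ofReal b₁ * ψ A * (P ^ j) x W₀ ≤ (P ^ (j + N)) x A := fun j => by
    rw [Kernel.pow_add_apply_eq_lintegral P j N x hA, ← setLIntegral_const]
    exact (setLIntegral_mono ((P ^ N).measurable_coe hA) fun y hy => hmin y hy A hA).trans
      (setLIntegral_le_lintegral _ _)
  have hsum : ENNReal.ofReal b₁ * ψ A * ENNReal.ofReal (1 / (2 * b)) ≤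
      ∑ k ∈ Finset.range (n + N + 1 + 1), (P ^ k) x A := by
    calc _ ≤ ENNReal.ofReal b₁ * ψ A * ∑ j ∈ Finset.range n, (P ^ j) x W₀ := by gcongr
      _ ≤ ∑ j ∈ Finset.range n, (P ^ (N + j)) x A := by
        rw [Finset.mul_sum]
        exact Finset.sum_le_sum fun j _ => by rw [add_comm N j]; exact hstep j
      _ ≤ ∑ k ∈ Finset.range (N + n), (P ^ k) x A := by
        rw [Finset.sum_range_add]; exact le_add_self
      _ ≤ _ := Finset.sum_le_sum_of_subset (Finset.range_mono (by omega))
  have hcoef : ENNReal.ofReal (min (b₁ * (1 / (2 * b)) / (n + N + 2)) 1) ≤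
      (((n + N + 1 : ℕ) : ℝ≥0∞) + 1)⁻¹ * (ENNReal.ofReal b₁ * ENNReal.ofReal (1 / (2 * b))) := by
    refine (ENNReal.ofReal_le_ofReal (min_le_left _ _)).trans (le_of_eq ?_)
    rw [ENNReal.ofReal_div_of_pos (by positivity), ENNReal.ofReal_mul hb₁.le, ENNReal.div_eq_inv_mul]
    congr 2
    rw [show ((n : ℝ) + N + 2) = ((n + N + 2 : ℕ) : ℝ) by push_cast; ring, ENNReal.ofReal_natCast]
    push_cast
    ring
  rw [cesaro_apply, Measure.smul_apply, Measure.finsetSum_apply, smul_eq_mul]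
  calc _ ≤ (((n + N + 1 : ℕ) : ℝ≥0∞) + 1)⁻¹ *
        (ENNReal.ofReal b₁ * ENNReal.ofReal (1 / (2 * b))) * ψ A := by gcongr
    _ = (((n + N + 1 : ℕ) : ℝ≥0∞) + 1)⁻¹ *
        (ENNReal.ofReal b₁ * ψ A * ENNReal.ofReal (1 / (2 * b))) := by ring
    _ ≤ _ := by gcongr

end CesaroDrift

section Stationary

variable {P : Kernel X X} [IsMarkovKernel P] {V : X → ℝ} {W₀ : Set X} {ρ b : ℝ}
  {ν : Measure X} [IsProbabilityMeasure ν]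

lemma invariant_pow (hν : Kernel.Invariant P ν) (k : ℕ) : Kernel.Invariant (P ^ k) ν := by
  induction k with
  | zero => rw [pow_zero]; exact Measure.bind_dirac
  | succ k ih => rw [pow_succ_eq_comp]; exact hν.comp ih

lemma integral_avg_eq_of_invariant {K : Kernel X X} [IsMarkovKernel K]
    (hν : Kernel.Invariant K ν) {f : X → ℝ} (hf : Integrable f ν) :
    ∫ x, avg K f x ∂ν = ∫ x, f x ∂ν := by
  have hK : (K ∘ₖ Kernel.const Unit ν) () = ν :=
    (Measure.comp_eq_comp_const_apply).symm.trans hν.def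
  have hf' : Integrable f ((K ∘ₖ Kernel.const Unit ν) ()) := by rwa [hK]
  have := Kernel.integral_comp hf'
  rw [hK] at this
  exact this.symm

/-- A stationary distribution integrates the Lyapunov function. -/
lemma HasDrift.integrable_of_invariant (h : HasDrift P V W₀ ρ b) (hν : Kernel.Invariant P ν) :
    Integrable V ν := by
  have hρ : 0 < 1 - ρ := sub_pos.2 h.rho_lt
  set c := b / (1 - ρ) with hc
  have hc0 : 0 ≤ c := div_nonneg h.b_pos.le hρ.le
  have hV0 : ∀ x, 0 ≤ V x := fun x => zero_le_one.trans (h.one_le x)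
  -- Invariance cannot be applied to `V` itself before its integrability is known. For the
  -- truncation it gives `ν (V ∧ M) ≤ ν ((ρ^k V + c) ∧ M)`, and the right side tends to `c ∧ M` as
  -- `k → ∞` by dominated convergence.
  have htrunc : ∀ M : ℕ, ∫⁻ x, ENNReal.ofReal (min (V x) M) ∂ν ≤ ENNReal.ofReal c := by
    intro M
    have hbd : ∀ k, ∫⁻ x, ENNReal.ofReal (min (V x) M) ∂ν ≤
        ∫⁻ x, ENNReal.ofReal (min (ρ ^ k * V x + c) M) ∂ν := by
      intro k
      have hm : Measurable fun x => ENNReal.ofReal (min (V x) M) :=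
        (h.measurable.min measurable_const).ennreal_ofReal
      calc ∫⁻ x, ENNReal.ofReal (min (V x) M) ∂ν
          = ∫⁻ x, ENNReal.ofReal (min (V x) M) ∂(ν.bind (P ^ k)) := by
            rw [(invariant_pow hν k).def]
        _ = ∫⁻ x, ∫⁻ y, ENNReal.ofReal (min (V y) M) ∂((P ^ k) x) ∂ν :=
            Measure.lintegral_bind (P ^ k).aemeasurable hm.aemeasurable
        _ ≤ _ := by
            refine lintegral_mono fun x => ?_
            have hint : Integrable (fun y => min (V y) (M : ℝ)) ((P ^ k) x) :=
              (h.integrable_pow k x).inf (integrable_const _)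
            rw [← ofReal_integral_eq_lintegral_ofReal hint
              (ae_of_all _ fun y => le_min (hV0 y) (Nat.cast_nonneg M))]
            refine ENNReal.ofReal_le_ofReal (le_min ?_ ?_)
            · exact (integral_mono hint (h.integrable_pow k x) fun y => min_le_left _ _).trans
                (h.integral_pow_le k x)
            · have := integral_mono hint (integrable_const (M : ℝ)) fun y => min_le_right _ _
              simpa using this
    have hlim : Tendsto (fun k : ℕ => ∫⁻ x, ENNReal.ofReal (min (ρ ^ k * V x + c) M) ∂ν) atTop
        (𝓝 (∫⁻ _, ENNReal.ofReal (min c M) ∂ν)) := by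
      refine tendsto_lintegral_of_dominated_convergence (fun _ => ENNReal.ofReal M)
        (fun k => (((h.measurable.const_mul _).add_const c).min
          measurable_const).ennreal_ofReal)
        (fun k => ae_of_all _ fun x => ENNReal.ofReal_le_ofReal (min_le_right _ _)) (by simp)
        (ae_of_all _ fun x => ?_)
      refine ENNReal.tendsto_ofReal (Tendsto.min ?_ tendsto_const_nhds)
      simpa using ((tendsto_pow_atTop_nhds_zero_of_lt_one h.rho_nonneg h.rho_lt).mul_const
        (V x)).add_const c
    refine (ge_of_tendsto' hlim hbd).trans ?_
    simp
  have hsup : ∫⁻ x, ENNReal.ofReal (V x) ∂ν ≤ ENNReal.ofReal c := by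
    have hpt : ∀ x, ENNReal.ofReal (V x) = ⨆ M : ℕ, ENNReal.ofReal (min (V x) M) := fun x => by
      refine le_antisymm ?_ (iSup_le fun M => ENNReal.ofReal_le_ofReal (min_le_left _ _))
      obtain ⟨M, hM⟩ := exists_nat_ge (V x)
      exact le_iSup_of_le M (by rw [min_eq_left hM])
    simp_rw [hpt]
    rw [lintegral_iSup (fun M => (h.measurable.min measurable_const).ennreal_ofReal)
      fun M M' hMM' x => ENNReal.ofReal_le_ofReal
        (min_le_min_left _ (by exact_mod_cast hMM'))]
    exact iSup_le htrunc
  refine ⟨h.measurable.aestronglyMeasurable, ?_⟩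
  rw [hasFiniteIntegral_iff_ofReal (ae_of_all _ hV0)]
  exact hsup.trans_lt ENNReal.ofReal_lt_top

end Stationary

end Harris

/-! ### The Poisson equation -/

section Harris

variable {X : Type*} [MeasurableSpace X]

/-- `Γ` solves, linearly and with a bound in the `V`-weighted norm, the Poisson equation
`g - P g = f - ν f`. -/
structure IsPoissonSolver (P : Kernel X X) (ν : Measure X) (V : X → ℝ) (c : ℝ)
    (Γ : (X → ℝ) → X → ℝ) : Prop where
  nonneg : 0 ≤ c
  bound : ∀ f s, 0 ≤ s → WBound V s f → WBound V (c * s) (Γ f)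
  sub : ∀ f g s r, 0 ≤ s → 0 ≤ r → WBound V s f → WBound V r g → ∀ x,
    Γ (fun y => f y - g y) x = Γ f x - Γ g x
  equation : ∀ f s, 0 ≤ s → WBound V s f → ∀ x, Γ f x - avg P (Γ f) x = f x - ∫ y, f y ∂ν

variable {V : X → ℝ} {ν : Measure X} [IsProbabilityMeasure ν]

lemma WBound.iterate_avg {K : Kernel X X} [IsMarkovKernel K] {C : ℝ} (hC : 0 ≤ C)
    (hKV : ∀ x, Integrable V (K x)) (hle : ∀ x, ∫ y, V y ∂(K x) ≤ C * V x)
    {f : X → ℝ} {s : ℝ} (hs : 0 ≤ s) (hf : WBound V s f) (n : ℕ) :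
    WBound V (s * C ^ n) ((avg K)^[n] f) := by
  induction n with
  | zero => simpa using hf
  | succ n ih =>
    rw [Function.iterate_succ_apply', pow_succ, ← mul_assoc]
    exact ih.integral_kernel (by positivity) hKV hle

/-- A kernel that contracts the weighted oscillation has a Poisson solver, given by the
Neumann series. -/
theorem exists_poissonSolver_of_contraction {K : Kernel X X} [IsMarkovKernel K] {C β α : ℝ}
    (hV : ∀ x, 1 ≤ V x) (hC : 0 ≤ C)
    (hKV : ∀ x, Integrable V (K x)) (hle : ∀ x, ∫ y, V y ∂(K x) ≤ C * V x)
    (hβ : 0 < β) (hα : 0 ≤ α) (hα1 : α < 1)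
    (hcontr : ∀ (f : X → ℝ) (s : ℝ), Measurable f → 0 ≤ s →
      (∀ x y, f x - f y ≤ s * (2 + β * (V x + V y))) →
      ∀ x y, avg K f x - avg K f y ≤ α * s * (2 + β * (V x + V y)))
    (hν : Kernel.Invariant K ν) (hνV : Integrable V ν) :
    ∃ c Γ, IsPoissonSolver K ν V c Γ := by
  have hV0 : ∀ x, 0 ≤ V x := fun x => zero_le_one.trans (hV x)
  have hit : ∀ {f s}, 0 ≤ s → WBound V s f → ∀ n, WBound V (s * C ^ n) ((avg K)^[n] f) :=
    fun hs hf n => hf.iterate_avg hC hKV hle hs n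
  have hosc : ∀ {f s}, 0 ≤ s → WBound V s f → ∀ n x y,
      (avg K)^[n] f x - (avg K)^[n] f y ≤ α ^ n * (s / β) * (2 + β * (V x + V y)) := by
    intro f s hs hf n
    induction n with
    | zero =>
      intro x y
      have h1 := (le_abs_self _).trans (hf.bound x)
      have h2 := (neg_le_abs _).trans (hf.bound y)
      have h3 : s / β * (2 + β * (V x + V y)) = 2 * (s / β) + s * (V x + V y) := by
        field_simp
      have h4 : 0 ≤ s / β := by positivity
      simp only [Function.iterate_zero, id, pow_zero, one_mul]
      linarith
    | succ n ih =>
      intro x y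
      rw [Function.iterate_succ_apply', pow_succ, mul_comm (α ^ n) α, mul_assoc α]
      exact hcontr _ _ (hit hs hf n).measurable (by positivity) ih x y
  have hmean : ∀ {f s}, 0 ≤ s → WBound V s f → ∀ n,
      ∫ y, (avg K)^[n] f y ∂ν = ∫ y, f y ∂ν := by
    intro f s hs hf n
    induction n with
    | zero => rfl
    | succ n ih =>
      rw [Function.iterate_succ_apply', integral_avg_eq_of_invariant hν
        ((hit hs hf n).integrable hνV), ih]
  set m : ℝ := ∫ y, V y ∂ν with hm
  have hm0 : 0 ≤ m := integral_nonneg hV0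
  set C₀ : ℝ := (2 + β + β * m) / β with hC₀
  have hC₀0 : 0 ≤ C₀ := by positivity
  -- Averaging the oscillation bound over the second point under `ν` replaces `K^n f y` by the
  -- stationary mean, which all the iterates share.
  have hdecay : ∀ {f s}, 0 ≤ s → WBound V s f → ∀ n x,
      |(avg K)^[n] f x - ∫ y, f y ∂ν| ≤ C₀ * s * V x * α ^ n := by
    intro f s hs hf n x
    have hi := (hit hs hf n).integrable hνV
    have hadd : Integrable (fun y => V x + V y) ν := (integrable_const _).add hνV
    have hi2 : Integrable (fun y => α ^ n * (s / β) * (2 + β * (V x + V y))) ν :=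
      ((integrable_const _).add (hadd.const_mul β)).const_mul _
    have hval : ∫ y, α ^ n * (s / β) * (2 + β * (V x + V y)) ∂ν =
        α ^ n * (s / β) * (2 + β * (V x + m)) := by
      rw [integral_const_mul, integral_add (integrable_const _)
        (hadd.const_mul β), integral_const_mul,
        integral_add (integrable_const _) hνV]
      simp [hm]
    have hfin : α ^ n * (s / β) * (2 + β * (V x + m)) ≤ C₀ * s * V x * α ^ n := by
      have h1 : 2 + β * (V x + m) ≤ (2 + β + β * m) * V x := by
        nlinarith [hV x, mul_nonneg hβ.le hm0]
      calc α ^ n * (s / β) * (2 + β * (V x + m))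
          ≤ α ^ n * (s / β) * ((2 + β + β * m) * V x) := by gcongr
        _ = _ := by rw [hC₀]; ring
    have h1 : (avg K)^[n] f x - ∫ y, f y ∂ν = ∫ y, ((avg K)^[n] f x - (avg K)^[n] f y) ∂ν := by
      rw [integral_sub (integrable_const _) hi, hmean hs hf n]
      simp
    have h2 : ∫ y, f y ∂ν - (avg K)^[n] f x = ∫ y, ((avg K)^[n] f y - (avg K)^[n] f x) ∂ν := by
      rw [integral_sub hi (integrable_const _), hmean hs hf n]
      simp
    refine abs_le'.2 ⟨?_, ?_⟩
    · rw [h1]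
      exact ((integral_mono ((integrable_const _).sub hi) hi2
        fun y => hosc hs hf n x y).trans hval.le).trans hfin
    · rw [neg_sub, h2]
      refine ((integral_mono (hi.sub (integrable_const _)) hi2
        fun y => ?_).trans hval.le).trans hfin
      have := hosc hs hf n y x
      rwa [add_comm (V y)] at this
  have hgeo : ∀ r : ℝ, Summable fun n : ℕ => r * α ^ n := fun r =>
    (summable_geometric_of_lt_one hα hα1).mul_left r
  have hsum : ∀ {f s}, 0 ≤ s → WBound V s f → ∀ x,
      Summable fun n => (avg K)^[n] f x - ∫ y, f y ∂ν := fun hs hf x =>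
    Summable.of_norm_bounded (hgeo _) fun n => (Real.norm_eq_abs _).trans_le (hdecay hs hf n x)
  refine ⟨C₀ * (1 - α)⁻¹, fun f x => ∑' n, ((avg K)^[n] f x - ∫ y, f y ∂ν),
    mul_nonneg hC₀0 (inv_nonneg.2 (by linarith)), fun f s hs hf => ⟨?_, fun x => ?_⟩,
    fun f g s r hs hr hf hg x => ?_, fun f s hs hf x => ?_⟩
  · refine measurable_of_tendsto_metrizable (f := fun N : ℕ => fun x =>
      ∑ n ∈ Finset.range N, ((avg K)^[n] f x - ∫ y, f y ∂ν)) (fun N => ?_)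
      (tendsto_pi_nhds.2 fun x => (hsum hs hf x).hasSum.tendsto_sum_nat)
    exact Finset.measurable_sum _ fun n _ => (hit hs hf n).measurable.sub_const _
  · have := tsum_of_norm_bounded ((hasSum_geometric_of_lt_one hα hα1).mul_left (C₀ * s * V x))
      fun n => (Real.norm_eq_abs _).trans_le (hdecay hs hf n x)
    rw [Real.norm_eq_abs] at this
    exact this.trans (le_of_eq (by ring))
  · rw [← (hsum hs hf x).tsum_sub (hsum hr hg x)]
    refine tsum_congr fun n => ?_
    have hn : ∀ n, (avg K)^[n] (fun y => f y - g y) =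
        fun y => (avg K)^[n] f y - (avg K)^[n] g y := fun n => by
      induction n with
      | zero => rfl
      | succ n ih =>
        rw [Function.iterate_succ_apply', Function.iterate_succ_apply',
          Function.iterate_succ_apply', ih]
        funext y
        exact integral_sub ((hit hs hf n).integrable (hKV y)) ((hit hr hg n).integrable (hKV y))
    rw [hn, integral_sub (hf.integrable hνV) (hg.integrable hνV)]
    ring
  · have hmeas : ∀ n, WBound V (C₀ * s * α ^ n)
        (fun x => (avg K)^[n] f x - ∫ y, f y ∂ν) := fun n =>
      ⟨(hit hs hf n).measurable.sub_const _, fun x => (hdecay hs hf n x).trans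
        (le_of_eq (by ring))⟩
    have hint : ∀ n, ∫ y, ((avg K)^[n] f y - ∫ z, f z ∂ν) ∂(K x) =
        (avg K)^[n + 1] f x - ∫ z, f z ∂ν := fun n => by
      rw [integral_sub ((hit hs hf n).integrable (hKV x)) (integrable_const _),
        Function.iterate_succ_apply']
      simp [avg]
    -- Applying `K` term by term shifts the Neumann series by one index, so `Γ f - K (Γ f)` is its
    -- zeroth term.
    have hswap := hasSum_integral_of_summable_integral_norm (μ := K x)
      (F := fun n y => (avg K)^[n] f y - ∫ z, f z ∂ν)
      (fun n => (hmeas n).integrable (hKV x)) ?_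
    · simp only [hint] at hswap
      have h0 := (hsum hs hf x).tsum_eq_zero_add
      have h1 := hswap.tsum_eq
      rw [h0, h1, avg]
      simp
    · refine Summable.of_nonneg_of_le (fun n => integral_nonneg fun y => norm_nonneg _)
        (fun n => ?_) (hgeo (C₀ * s * ∫ y, V y ∂(K x)))
      have := integral_mono ((hmeas n).integrable (hKV x)).norm
        ((hKV x).const_mul (C₀ * s * α ^ n)) (hmeas n).bound
      rw [integral_const_mul] at this
      exact this.trans (le_of_eq (by ring))

/-- A geometric drift towards a small set yields a Poisson solver; the argument applies
Harris' theorem to a Cesàro mean of the powers of the kernel, so that neither irreducibility nor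
aperiodicity plays a role. -/
theorem HasDrift.exists_poissonSolver {P : Kernel X X} [IsMarkovKernel P] {W₀ : Set X} {ρ b : ℝ}
    (h : HasDrift P V W₀ ρ b) {N : ℕ} {b₁ : ℝ} (hb₁ : 0 < b₁) {ψ : Measure X}
    [IsProbabilityMeasure ψ]
    (hmin : ∀ x ∈ W₀, ∀ A : Set X, MeasurableSet A → ENNReal.ofReal b₁ * ψ A ≤ (P ^ N) x A)
    (hν : Kernel.Invariant P ν) : ∃ c Γ, IsPoissonSolver P ν V c Γ := by
  have hρ := h.rho_nonneg
  have hρ1 := h.rho_lt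
  have hV0 : ∀ x, 0 ≤ V x := fun x => zero_le_one.trans (h.one_le x)
  have hνV := h.integrable_of_invariant hν
  set c := b / (1 - ρ) with hc
  have hc0 : 0 ≤ c := div_nonneg h.b_pos.le (by linarith)
  -- With `γ = (1 + ρ) / 2`, this level `R` satisfies `(1 - γ) * R = 2 * c + 1`, just above the `2 *
  -- c` that Harris' theorem demands.
  obtain ⟨M, hM, ε, hε, hε1, hmin'⟩ :=
    h.exists_cesaro_minorization hb₁ hmin (2 * (2 * c + 1) / (1 - ρ))
  have hKV : ∀ x, Integrable V (cesaro P M x) := fun x =>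
    integrable_cesaro fun k => h.integrable_pow k x
  have hdrift := h.integral_cesaro_le hM
  obtain ⟨β, α, hβ, hα, hα1, hcontr⟩ := exists_contraction h.one_le hKV
    (by linarith : (1 + ρ) / 2 < 1) hc0 hdrift
    (by
      have : (1 - (1 + ρ) / 2) * (2 * (2 * c + 1) / (1 - ρ)) = 2 * c + 1 := by
        have : 1 - ρ ≠ 0 := by linarith
        field_simp
        ring
      linarith) hε hε1 hmin'
  have hpowint : ∀ {f s}, WBound V s f → ∀ k x, Integrable f ((P ^ k) x) :=
    fun hf k x => hf.integrable (h.integrable_pow k x)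
  have hKinv : Kernel.Invariant (cesaro P M) ν := by
    refine Measure.ext fun A hA => ?_
    rw [Measure.bind_apply hA (cesaro P M).aemeasurable]
    simp only [cesaro_apply, Measure.smul_apply, Measure.finsetSum_apply, smul_eq_mul]
    rw [lintegral_const_mul _ (Finset.measurable_sum _ fun k _ => (P ^ k).measurable_coe hA),
      lintegral_finsetSum _ fun k _ => (P ^ k).measurable_coe hA]
    have : ∀ k, ∫⁻ x, (P ^ k) x A ∂ν = ν A := fun k => by
      rw [← Measure.bind_apply hA (P ^ k).aemeasurable, (invariant_pow hν k).def]
    simp only [this, Finset.sum_const, Finset.card_range, nsmul_eq_mul]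
    rw [← mul_assoc, Nat.cast_add, Nat.cast_one, ENNReal.inv_mul_cancel (by simp) (by finiteness),
      one_mul]
  have hscale : ∀ x, (1 + ρ) / 2 * V x + c ≤ (1 + c) * V x := fun x => by
    nlinarith [h.one_le x]
  obtain ⟨c₁, Γ, hΓ⟩ := exists_poissonSolver_of_contraction h.one_le (by linarith : 0 ≤ 1 + c) hKV
    (fun x => (hdrift x).trans (hscale x)) hβ hα hα1 hcontr hKinv hνV
  have hc₁ := hΓ.nonneg
  have hpow : ∀ k x, ∫ y, V y ∂((P ^ k) x) ≤ (1 + c) * V x := fun k x => by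
    have h1 := h.integral_pow_le k x
    have h2 : ρ ^ k * V x ≤ 1 * V x :=
      mul_le_mul_of_nonneg_right (pow_le_one₀ hρ hρ1.le) (hV0 x)
    nlinarith [h.one_le x]
  have hstep : ∀ {f s}, 0 ≤ s → WBound V s f → ∀ k x,
      avg P (avg (P ^ k) f) x = avg (P ^ (k + 1)) f x := by
    intro f s hs hf k x
    have hi := hpowint hf (k + 1) x
    simp only [avg]
    rw [Kernel.pow_add, pow_one] at hi ⊢
    exact (Kernel.integral_comp hi).symm
  have hpowW : ∀ {f s}, 0 ≤ s → WBound V s f → ∀ k, WBound V (s * (1 + c)) (avg (P ^ k) f) :=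
    fun hs hf k => hf.integral_kernel hs (h.integrable_pow k) (hpow k)
  set κ : ℝ := ((M : ℝ) + 1)⁻¹ with hκ
  have hκ0 : 0 ≤ κ := by positivity
  set n : ℝ := ∑ k ∈ Finset.range (M + 1), (k : ℝ) with hn
  have hn0 : 0 ≤ n := Finset.sum_nonneg fun _ _ => Nat.cast_nonneg _
  -- With `K` the Cesàro mean, `I - K` is the mean of the `I - P^k`, and `I - P^k = (I - P) ∑_{j <
  -- k} P^j`. Hence this double sum applied to the solution for `K` solves the equation for `P`.
  refine ⟨κ * n * (1 + c) * c₁, fun f x => κ * ∑ k ∈ Finset.range (M + 1),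
    ∑ j ∈ Finset.range k, avg (P ^ j) (Γ f) x, by positivity, fun f s hs hf => ⟨?_, fun x => ?_⟩,
    fun f g s r hs hr hf hg x => ?_, fun f s hs hf x => ?_⟩
  · have hg := hΓ.bound f s hs hf
    exact (Finset.measurable_sum _ fun k _ => Finset.measurable_sum _ fun j _ =>
      (hpowW (by positivity) hg j).measurable).const_mul _
  · have hg := hΓ.bound f s hs hf
    rw [abs_mul, abs_of_nonneg hκ0]
    have : |∑ k ∈ Finset.range (M + 1), ∑ j ∈ Finset.range k, avg (P ^ j) (Γ f) x| ≤
        ∑ k ∈ Finset.range (M + 1), (k : ℝ) * (c₁ * s * (1 + c) * V x) := by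
      refine (Finset.abs_sum_le_sum_abs _ _).trans (Finset.sum_le_sum fun k _ => ?_)
      refine (Finset.abs_sum_le_sum_abs _ _).trans ?_
      refine (Finset.sum_le_sum fun j _ => (hpowW (by positivity) hg j).bound x).trans ?_
      simp
    rw [← Finset.sum_mul] at this
    exact (mul_le_mul_of_nonneg_left this hκ0).trans (le_of_eq (by rw [← hn]; ring))
  · have h1 := hΓ.bound f s hs hf
    have h2 := hΓ.bound g r hr hg
    have h3 : ∀ j, avg (P ^ j) (Γ fun y => f y - g y) x =
        avg (P ^ j) (Γ f) x - avg (P ^ j) (Γ g) x := fun j => by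
      rw [show (Γ fun y => f y - g y) = fun y => Γ f y - Γ g y from
        funext (hΓ.sub f g s r hs hr hf hg)]
      exact integral_sub (hpowint h1 j x) (hpowint h2 j x)
    simp only [h3, Finset.sum_sub_distrib, mul_sub]
  · have hg := hΓ.bound f s hs hf
    have hs' : 0 ≤ c₁ * s := by positivity
    have hint : ∀ j, Integrable (avg (P ^ j) (Γ f)) (P x) := fun j =>
      (hpowW hs' hg j).integrable (h.integrable x)
    have h0 : avg (P ^ 0) (Γ f) x = Γ f x := by
      have : (P ^ 0) x = Measure.dirac x := by
        rw [pow_zero]; exact Kernel.id_apply x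
      rw [avg, this, integral_dirac' _ _ hg.measurable.stronglyMeasurable]
    have h1 : avg P (fun x => κ * ∑ k ∈ Finset.range (M + 1), ∑ j ∈ Finset.range k,
        avg (P ^ j) (Γ f) x) x = κ * ∑ k ∈ Finset.range (M + 1), ∑ j ∈ Finset.range k,
        avg (P ^ (j + 1)) (Γ f) x := by
      rw [avg, integral_const_mul, integral_finsetSum _ fun k _ =>
        integrable_finsetSum _ fun j _ => hint j]
      congr 1
      refine Finset.sum_congr rfl fun k _ => ?_
      rw [integral_finsetSum _ fun j _ => hint j]
      exact Finset.sum_congr rfl fun j _ => hstep hs' hg j x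
    rw [h1, ← mul_sub, ← Finset.sum_sub_distrib]
    have h2 : ∀ k, ∑ j ∈ Finset.range k, avg (P ^ j) (Γ f) x -
        ∑ j ∈ Finset.range k, avg (P ^ (j + 1)) (Γ f) x = Γ f x - avg (P ^ k) (Γ f) x := fun k => by
      rw [← Finset.sum_sub_distrib, Finset.sum_range_sub' (fun j => avg (P ^ j) (Γ f) x), h0]
    simp only [h2]
    rw [Finset.sum_sub_distrib, Finset.sum_const, Finset.card_range, nsmul_eq_mul, mul_sub]
    have h3 := hΓ.equation f s hs hf x
    have h4 : avg (cesaro P M) (Γ f) x = κ * ∑ k ∈ Finset.range (M + 1), avg (P ^ k) (Γ f) x :=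
      integral_cesaro fun k => hpowint hg k x
    rw [← h4, ← mul_assoc]
    have h5 : κ * ((M + 1 : ℕ) : ℝ) = 1 := by
      push_cast
      exact inv_mul_cancel₀ (by positivity)
    rw [h5, one_mul, h3]

end Harris

/-! ### Drift for the square root of the Lyapunov function -/

section Drift

variable {X : Type*} [MeasurableSpace X] {P : Kernel X X} [IsMarkovKernel P] {V : X → ℝ}
  {W₀ : Set X} {ρ b : ℝ}

lemma hasDrift_of_lintegral_le (hVm : Measurable V) (hV : ∀ x, 1 ≤ V x) (hW₀ : MeasurableSet W₀)
    (hρ : 0 ≤ ρ) (hρ1 : ρ < 1) (hb : 0 < b)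
    (h : ∀ x, ∫⁻ y, ENNReal.ofReal (V y) ∂(P x) ≤
      ENNReal.ofReal (ρ * V x + W₀.indicator (fun _ => b) x)) :
    HasDrift P V W₀ ρ b where
  measurable := hVm
  one_le := hV
  measurableSet := hW₀
  rho_nonneg := hρ
  rho_lt := hρ1
  b_pos := hb
  integrable x := by
    refine ⟨hVm.aestronglyMeasurable, ?_⟩
    rw [hasFiniteIntegral_iff_ofReal (ae_of_all _ fun y => zero_le_one.trans (hV y))]
    exact (h x).trans_lt ENNReal.ofReal_lt_top
  le x := by
    rw [integral_eq_lintegral_of_nonneg_ae (ae_of_all _ fun y => zero_le_one.trans (hV y))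
      hVm.aestronglyMeasurable]
    refine ENNReal.toReal_le_of_le_ofReal ?_ (h x)
    exact add_nonneg (mul_nonneg hρ (zero_le_one.trans (hV x)))
      (Set.indicator_nonneg (fun _ _ => hb.le) x)

/-- Jensen's inequality and subadditivity of the square root. The passage to the root keeps the
squares of the Poisson solutions under control of the original function. -/
lemma HasDrift.sqrt (h : HasDrift P V W₀ ρ b) :
    HasDrift P (fun x => √(V x)) W₀ (√ρ) (√b) := by
  have hV0 : ∀ x, 0 ≤ V x := fun x => zero_le_one.trans (h.one_le x)
  have hle : ∀ x, √(V x) ≤ V x := fun x => by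
    rw [Real.sqrt_le_left (hV0 x)]
    nlinarith [h.one_le x]
  have hint : ∀ x, Integrable (fun y => √(V y)) (P x) := fun x =>
    (h.integrable x).mono' h.measurable.sqrt.aestronglyMeasurable (ae_of_all _ fun y => by
      rw [Real.norm_of_nonneg (Real.sqrt_nonneg _)]; exact hle y)
  refine ⟨h.measurable.sqrt, fun x => Real.one_le_sqrt.2 (h.one_le x), h.measurableSet,
    Real.sqrt_nonneg _, ?_, Real.sqrt_pos.2 h.b_pos, hint, fun x => ?_⟩
  · rw [Real.sqrt_lt' one_pos]
    simpa using h.rho_lt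
  · set q := ρ * V x + W₀.indicator (fun _ => b) x with hq
    have hq1 : 1 ≤ q := by
      have := integral_mono (integrable_const 1) (h.integrable x) h.one_le
      simp only [integral_const, probReal_univ, smul_eq_mul, mul_one] at this
      exact this.trans (h.le x)
    have hs : 0 < √q := Real.sqrt_pos.2 (by linarith)
    have hmean : ∫ y, √(V y) ∂(P x) ≤ √q := by
      -- The tangent line of the square root at `q`; integrating it is Jensen's inequality.
      have h1 : ∀ y, √(V y) ≤ (2 * √q)⁻¹ * V y + √q / 2 := fun y => by
        have e := Real.sq_sqrt (hV0 y)
        have : (2 * √q)⁻¹ * V y + √q / 2 - √(V y) = (√(V y) - √q) ^ 2 / (2 * √q) := by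
          field_simp
          nlinarith
        have h2 : 0 ≤ (√(V y) - √q) ^ 2 / (2 * √q) := by positivity
        linarith
      have h2 := integral_mono (hint x)
        (((h.integrable x).const_mul (2 * √q)⁻¹).add (integrable_const (√q / 2))) h1
      refine h2.trans ?_
      simp only [Pi.add_apply]
      rw [integral_add ((h.integrable x).const_mul _) (integrable_const _), integral_const_mul]
      have h3 : (2 * √q)⁻¹ * ∫ y, V y ∂(P x) ≤ (2 * √q)⁻¹ * q :=
        mul_le_mul_of_nonneg_left (h.le x) (by positivity)
      have h4 : (2 * √q)⁻¹ * q = √q / 2 := by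
        have := Real.mul_self_sqrt (by linarith : 0 ≤ q)
        field_simp
        nlinarith
      simp only [integral_const, probReal_univ, smul_eq_mul, one_mul]
      linarith
    refine hmean.trans ?_
    have hsplit : √q ≤ √(ρ * V x) + √(W₀.indicator (fun _ => b) x) := by
      have e1 := Real.sq_sqrt (mul_nonneg h.rho_nonneg (hV0 x))
      have e2 := Real.sq_sqrt (Set.indicator_nonneg (fun _ _ => h.b_pos.le) x :
        0 ≤ W₀.indicator (fun _ => b) x)
      refine Real.sqrt_le_iff.2 ⟨by positivity, ?_⟩
      nlinarith [mul_nonneg (Real.sqrt_nonneg (ρ * V x))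
        (Real.sqrt_nonneg (W₀.indicator (fun _ => b) x))]
    refine hsplit.trans (le_of_eq ?_)
    rw [Real.sqrt_mul h.rho_nonneg]
    congr 1
    by_cases hx : x ∈ W₀ <;> simp [hx]

end Drift

/-! ### Markov property and moments along the chain -/

section Chain

variable {m : ℕ} {S : Set (Vec m)} {P : Kernel S S} [IsMarkovKernel P] {w : S}
  {Ω : Type*} [mΩ : MeasurableSpace Ω] {μ : Measure Ω} [IsProbabilityMeasure μ]
  {ℱ : Filtration ℕ mΩ} {W : ℕ → Ω → S}

namespace IsMarkovChainFrom

lemma measurable (hW : IsMarkovChainFrom P w μ ℱ W) (t : ℕ) : Measurable (W t) :=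
  (hW.adapted t).mono (ℱ.le t) le_rfl

lemma measure_inter (hW : IsMarkovChainFrom P w μ ℱ W) (t : ℕ) {E : Set Ω}
    (hE : MeasurableSet[ℱ t] E) {A : Set S} (hA : MeasurableSet A) :
    μ (E ∩ W (t + 1) ⁻¹' A) = ∫⁻ ω in E, P (W t ω) A ∂μ := by
  have hA' : MeasurableSet (W (t + 1) ⁻¹' A) := hW.measurable (t + 1) hA
  have h1 := setIntegral_condExp (ℱ.le t)
    ((integrable_const (1 : ℝ)).indicator hA' : Integrable ((W (t + 1) ⁻¹' A).indicator
      fun _ => (1 : ℝ)) μ) hE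
  have h2 : ∫ ω in E, (P (W t ω)).real A ∂μ = μ.real (E ∩ W (t + 1) ⁻¹' A) := by
    rw [← setIntegral_congr_ae (ℱ.le t _ hE) ((hW.markov t A hA).mono fun ω h _ => h), h1,
      integral_indicator_const _ hA', smul_eq_mul, mul_one, measureReal_restrict_apply hA',
      Set.inter_comm]
  have h3 : Measurable fun ω => (P (W t ω)).real A :=
    ((P.measurable_coe hA).comp (hW.measurable t)).ennreal_toReal
  have h4 : ∫⁻ ω in E, P (W t ω) A ∂μ = ∫⁻ ω in E, ENNReal.ofReal ((P (W t ω)).real A) ∂μ := by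
    simp [ofReal_measureReal]
  rw [h4, ← ofReal_integral_eq_lintegral_ofReal, h2, ofReal_measureReal]
  · exact (integrable_const (1 : ℝ)).mono' h3.aestronglyMeasurable (ae_of_all _ fun ω => by
      rw [Real.norm_of_nonneg measureReal_nonneg]; exact measureReal_le_one)
  · exact ae_of_all _ fun ω => measureReal_nonneg

/-- The Markov property, for the joint law of the past and the next state. -/
lemma map_restrict (hW : IsMarkovChainFrom P w μ ℱ W) (t : ℕ) {Θ : Type*} [MeasurableSpace Θ]
    {Y : Ω → Θ} (hY : Measurable[ℱ t] Y) {E : Set Ω} (hE : MeasurableSet[ℱ t] E) :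
    (μ.restrict E).map (fun ω => ((Y ω, W t ω), W (t + 1) ω)) =
      ((μ.restrict E).map fun ω => (Y ω, W t ω)) ⊗ₘ Kernel.prodMkLeft Θ P := by
  have hYW : Measurable[ℱ t] fun ω => (Y ω, W t ω) := hY.prodMk (hW.adapted t)
  have hYW' : Measurable fun ω => (Y ω, W t ω) := hYW.mono (ℱ.le t) le_rfl
  refine Measure.ext_prod fun {s A} hs hA => ?_
  rw [Measure.map_apply (hYW'.prodMk (hW.measurable (t + 1))) (hs.prod hA),
    Measure.compProd_apply_prod hs hA, setLIntegral_map hs ((Kernel.measurable_coe _ hA)) hYW',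
    Measure.restrict_restrict (hYW' hs), Set.mk_preimage_prod,
    Measure.restrict_apply ((hYW' hs).inter (hW.measurable (t + 1) hA))]
  have := hW.measure_inter t (E := (fun ω => (Y ω, W t ω)) ⁻¹' s ∩ E) ((hYW hs).inter hE) hA
  simp only [Kernel.prodMkLeft_apply]
  rw [← this]
  congr 1
  ext ω
  simp only [Set.mem_inter_iff]
  tauto

/-- Allows a random parameter known at time `t` to be frozen while the next state is integrated out;
it is used with the current iterates as parameter. -/
lemma setIntegral_eq (hW : IsMarkovChainFrom P w μ ℱ W) (t : ℕ) {Θ : Type*} [MeasurableSpace Θ]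
    {Y : Ω → Θ} (hY : Measurable[ℱ t] Y) {E : Set Ω} (hE : MeasurableSet[ℱ t] E)
    {g : Θ × S → ℝ} (hg : Measurable g) (hint : Integrable (fun ω => g (Y ω, W (t + 1) ω)) μ) :
    ∫ ω in E, g (Y ω, W (t + 1) ω) ∂μ = ∫ ω in E, ∫ y, g (Y ω, y) ∂(P (W t ω)) ∂μ := by
  have hYm : Measurable Y := hY.mono (ℱ.le t) le_rfl
  have hYW : Measurable fun ω => (Y ω, W t ω) := hYm.prodMk (hW.measurable t)
  have hYWW : Measurable fun ω => ((Y ω, W t ω), W (t + 1) ω) :=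
    hYW.prodMk (hW.measurable (t + 1))
  set g' : (Θ × S) × S → ℝ := fun p => g (p.1.1, p.2) with hg'
  have hgm : Measurable g' := hg.comp (by fun_prop)
  have h1 : ∫ ω in E, g (Y ω, W (t + 1) ω) ∂μ =
      ∫ p, g' p ∂((μ.restrict E).map fun ω => ((Y ω, W t ω), W (t + 1) ω)) := by
    rw [integral_map hYWW.aemeasurable hgm.aestronglyMeasurable]
  have h2 : Integrable g' ((μ.restrict E).map fun ω => ((Y ω, W t ω), W (t + 1) ω)) :=
    (integrable_map_measure hgm.aestronglyMeasurable hYWW.aemeasurable).2 hint.integrableOn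
  rw [h1]
  rw [hW.map_restrict t hY hE] at h2 ⊢
  rw [Measure.integral_compProd h2, integral_map hYW.aemeasurable]
  · simp [hg']
  · exact (hgm.stronglyMeasurable.integral_kernel_prod_right').aestronglyMeasurable

lemma setLIntegral_eq (hW : IsMarkovChainFrom P w μ ℱ W) (t : ℕ) {E : Set Ω}
    (hE : MeasurableSet[ℱ t] E) {u : S → ℝ≥0∞} (hu : Measurable u) :
    ∫⁻ ω in E, u (W (t + 1) ω) ∂μ = ∫⁻ ω in E, ∫⁻ y, u y ∂(P (W t ω)) ∂μ := by
  have hYW : Measurable fun ω => (W t ω, W t ω) := (hW.measurable t).prodMk (hW.measurable t)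
  have hYWW : Measurable fun ω => ((W t ω, W t ω), W (t + 1) ω) :=
    hYW.prodMk (hW.measurable (t + 1))
  have h1 : ∫⁻ ω in E, u (W (t + 1) ω) ∂μ =
      ∫⁻ p, u p.2 ∂((μ.restrict E).map fun ω => ((W t ω, W t ω), W (t + 1) ω)) :=
    (lintegral_map (hu.comp measurable_snd) hYWW).symm
  rw [h1, hW.map_restrict t (hW.adapted t) hE, Measure.lintegral_compProd (by fun_prop),
    lintegral_map _ hYW]
  · simp
  · exact (hu.comp measurable_snd).lintegral_kernel_prod_right'

lemma integrable_and_integral_le (hW : IsMarkovChainFrom P w μ ℱ W) {U : S → ℝ} {W₀ : Set S}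
    {ρ b : ℝ} (h : HasDrift P U W₀ ρ b) (t : ℕ) :
    Integrable (fun ω => U (W t ω)) μ ∧ ∫ ω, U (W t ω) ∂μ ≤ U w + b / (1 - ρ) := by
  have hρ : 0 < 1 - ρ := sub_pos.2 h.rho_lt
  have hU0 : ∀ x, 0 ≤ U x := fun x => zero_le_one.trans (h.one_le x)
  have hstep : ∀ x, ∫ y, U y ∂(P x) ≤ ρ * U x + b := fun x =>
    (h.le x).trans (by gcongr; exact Set.indicator_le_self' (fun _ _ => h.b_pos.le) x)
  induction t with
  | zero =>
    have hae : (fun ω => U (W 0 ω)) =ᵐ[μ] fun _ => U w := hW.initial.mono fun ω hω => by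
      simp only [hω]
    refine ⟨(integrable_const _).congr hae.symm, ?_⟩
    rw [integral_congr_ae hae]
    have := div_nonneg h.b_pos.le hρ.le
    simpa using this
  | succ t ih =>
    obtain ⟨hi, hle⟩ := ih
    have hm : Measurable fun ω => U (W (t + 1) ω) := h.measurable.comp (hW.measurable _)
    have hi' : Integrable (fun ω => ρ * U (W t ω) + b) μ :=
      (hi.const_mul ρ).add (integrable_const b)
    have hint : Integrable (fun ω => U (W (t + 1) ω)) μ := by
      refine ⟨hm.aestronglyMeasurable, ?_⟩
      rw [hasFiniteIntegral_iff_ofReal (ae_of_all _ fun ω => hU0 _)]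
      have h1 := hW.setLIntegral_eq t MeasurableSet.univ h.measurable.ennreal_ofReal
      rw [Measure.restrict_univ] at h1
      rw [h1]
      refine lt_of_le_of_lt (lintegral_mono (g := fun ω => ENNReal.ofReal (ρ * U (W t ω) + b))
        fun ω => ?_) (hi'.lintegral_lt_top)
      rw [← ofReal_integral_eq_lintegral_ofReal (h.integrable _) (ae_of_all _ hU0)]
      exact ENNReal.ofReal_le_ofReal (hstep _)
    refine ⟨hint, ?_⟩
    have h1 := hW.setIntegral_eq t (hW.adapted t) MeasurableSet.univ
      (g := fun p => U p.2) (h.measurable.comp measurable_snd) hint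
    simp only [Measure.restrict_univ] at h1
    rw [h1]
    have h2 : ∫ ω, ∫ y, U y ∂(P (W t ω)) ∂μ ≤ ∫ ω, (ρ * U (W t ω) + b) ∂μ :=
      integral_mono_of_nonneg (ae_of_all _ fun ω => integral_nonneg hU0) hi'
        (ae_of_all _ fun ω => hstep _)
    rw [integral_add (hi.const_mul ρ) (integrable_const b), integral_const_mul] at h2
    simp only [integral_const, probReal_univ, smul_eq_mul, one_mul] at h2
    have h3 : ρ * (b / (1 - ρ)) + b = b / (1 - ρ) := by field_simp; ring
    have h4 := mul_le_mul_of_nonneg_left hle h.rho_nonneg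
    nlinarith [hU0 w]

lemma setIntegral_le (hW : IsMarkovChainFrom P w μ ℱ W) {U : S → ℝ} {W₀ : Set S}
    {ρ b : ℝ} (h : HasDrift P U W₀ ρ b) (t : ℕ) {E : Set Ω} (hE : MeasurableSet[ℱ t] E) :
    ∫ ω in E, U (W (t + 1) ω) ∂μ ≤ (1 + b) * ∫ ω in E, U (W t ω) ∂μ := by
  have hU0 : ∀ x, 0 ≤ U x := fun x => zero_le_one.trans (h.one_le x)
  have h1 := hW.setIntegral_eq t (hW.adapted t) hE
      (g := fun p => U p.2) (h.measurable.comp measurable_snd)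
      (hW.integrable_and_integral_le h (t + 1)).1
  rw [← integral_const_mul, h1]
  refine integral_mono_of_nonneg (ae_of_all _ fun ω => integral_nonneg hU0)
    ((hW.integrable_and_integral_le h t).1.integrableOn.const_mul _) (ae_of_all _ fun ω => ?_)
  refine (h.le _).trans ?_
  have h2 : W₀.indicator (fun _ => b) (W t ω) ≤ b :=
    Set.indicator_le_self' (fun _ _ => h.b_pos.le) _
  nlinarith [h.one_le (W t ω), h.rho_lt, h.b_pos]

end IsMarkovChainFrom

end Chain

/-! ### Projection onto the ball -/

section BallProj

variable {d : ℕ} {B : ℝ}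

lemma norm_ballProj_le (hB : 0 < B) (x : Vec d) : ‖ballProj B x‖ ≤ B := by
  unfold ballProj
  split_ifs with h
  · exact h
  · have hx : 0 < ‖x‖ := hB.trans (not_le.1 h)
    rw [norm_smul, Real.norm_of_nonneg (by positivity), div_mul_cancel₀ _ hx.ne']

lemma ballProj_of_norm_le {x : Vec d} (h : ‖x‖ ≤ B) : ballProj B x = x := if_pos h

/-- The variational inequality of a metric projection; nonexpansiveness follows from adding two
instances of it. -/
lemma inner_sub_ballProj_le (hB : 0 < B) (x : Vec d) {y : Vec d} (hy : ‖y‖ ≤ B) :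
    inner ℝ (x - ballProj B x) (y - ballProj B x) ≤ 0 := by
  unfold ballProj
  split_ifs with h
  · simp
  · have hx : 0 < ‖x‖ := hB.trans (not_le.1 h)
    have h1 : x - (B / ‖x‖) • x = (1 - B / ‖x‖) • x := by rw [sub_smul, one_smul]
    have h2 : B / ‖x‖ ≤ 1 := (div_le_one hx).2 (not_le.1 h).le
    rw [h1, inner_smul_left, inner_sub_right, inner_smul_right, real_inner_self_eq_norm_sq]
    have h3 : inner ℝ x y ≤ ‖x‖ * B :=
      (real_inner_le_norm x y).trans (mul_le_mul_of_nonneg_left hy hx.le)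
    have h4 : B / ‖x‖ * ‖x‖ ^ 2 = ‖x‖ * B := by field_simp
    rw [h4]
    exact mul_nonpos_of_nonneg_of_nonpos (by simpa using h2) (by linarith)

lemma norm_ballProj_sub_le (hB : 0 < B) (x y : Vec d) :
    ‖ballProj B x - ballProj B y‖ ≤ ‖x - y‖ := by
  have h1 := inner_sub_ballProj_le hB x (norm_ballProj_le hB y)
  have h2 := inner_sub_ballProj_le hB y (norm_ballProj_le hB x)
  set p := ballProj B x
  set q := ballProj B y
  have h3 : inner ℝ (x - p) (q - p) + inner ℝ (y - q) (p - q) =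
      ‖p - q‖ ^ 2 - inner ℝ (x - y) (p - q) := by
    rw [← real_inner_self_eq_norm_sq]
    simp only [inner_sub_left, inner_sub_right, real_inner_comm]
    ring
  have h4 := real_inner_le_norm (x - y) (p - q)
  by_contra hlt
  nlinarith [norm_nonneg (x - y), norm_nonneg (p - q)]

lemma norm_ballProj_sub_le_of_norm_le (hB : 0 < B) (x : Vec d) {y : Vec d} (hy : ‖y‖ ≤ B) :
    ‖ballProj B x - y‖ ≤ ‖x - y‖ := by
  simpa only [ballProj_of_norm_le hy] using norm_ballProj_sub_le hB x y

lemma continuous_ballProj (hB : 0 < B) : Continuous (ballProj B : Vec d → Vec d) :=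
  (LipschitzWith.of_dist_le_mul (K := 1) fun x y => by
    simpa [dist_eq_norm] using norm_ballProj_sub_le hB x y).continuous

end BallProj

/-! ### Poisson solutions depending on the iterates -/

section Corrector

variable {m d dp : ℕ} {S : Set (Vec m)} {P : Kernel S S} [IsMarkovKernel P]
  {ν : Measure S} [IsProbabilityMeasure ν] {V : S → ℝ} {B L : ℝ}

/-- A random field with weighted linear growth and Lipschitz continuity on the ball of radius
`B`. -/
structure IsLipschitzField (V : S → ℝ) (B L : ℝ) (F : S → Vec d → Vec dp → Vec d) : Prop where
  measurable : Measurable fun q : S × Vec d × Vec dp => F q.1 q.2.1 q.2.2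
  nonneg : 0 ≤ L
  growth : ∀ w x p, ‖x‖ ≤ B → ‖p‖ ≤ B → ‖F w x p‖ ≤ L * V w
  lipschitz : ∀ w x p x' p', ‖x‖ ≤ B → ‖p‖ ≤ B → ‖x'‖ ≤ B → ‖p'‖ ≤ B →
    ‖F w x p - F w x' p'‖ ≤ L * V w * (‖x - x'‖ + ‖p - p'‖)

/-- A corrector: the solution `g x p` of the Poisson equation for `⟪x - x₀, F · x p⟫`. -/
structure IsCorrector (P : Kernel S S) (ν : Measure S) (V : S → ℝ) (B : ℝ)
    (F : S → Vec d → Vec dp → Vec d) (x₀ : Vec d) (c : ℝ) (g : Vec d → Vec dp → S → ℝ) :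
    Prop where
  nonneg : 0 ≤ c
  measurable : Measurable fun q : (Vec d × Vec dp) × S => g q.1.1 q.1.2 q.2
  bound : ∀ x p, ‖x‖ ≤ B → ‖p‖ ≤ B → ∀ w, |g x p w| ≤ c * ‖x - x₀‖ * V w
  lipschitz : ∀ x p x' p', ‖x‖ ≤ B → ‖p‖ ≤ B → ‖x'‖ ≤ B → ‖p'‖ ≤ B → ∀ w,
    |g x p w - g x' p' w| ≤ c * (‖x - x'‖ + ‖p - p'‖) * V w
  equation : ∀ x p, ‖x‖ ≤ B → ‖p‖ ≤ B → ∀ w, g x p w - avg P (g x p) w =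
    inner ℝ (x - x₀) (F w x p) - ∫ y, inner ℝ (x - x₀) (F y x p) ∂ν

/-- The solver respects differences and is bounded, so growth and Lipschitz bounds of the field in
its parameters pass to the solution. -/
lemma IsPoissonSolver.exists_corrector {c : ℝ} {Γ : (S → ℝ) → S → ℝ}
    (hΓ : IsPoissonSolver P ν V c Γ) (hV : ∀ x, 1 ≤ V x) (hB : 0 < B)
    {F : S → Vec d → Vec dp → Vec d}
    (hF : IsLipschitzField V B L F) {x₀ : Vec d} (hx₀ : ‖x₀‖ ≤ B) :
    ∃ c' g, IsCorrector P ν V B F x₀ c' g := by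
  have hV0 : ∀ x, 0 ≤ V x := fun x => zero_le_one.trans (hV x)
  have hc := hΓ.nonneg
  have hL := hF.nonneg
  set f : Vec d → Vec dp → S → ℝ := fun x p w => inner ℝ (x - x₀) (F w x p) with hf
  have hfm : ∀ x p, Measurable (f x p) := fun x p => by
    have : Measurable fun w => F w x p := hF.measurable.comp (measurable_id.prodMk (measurable_const (a := (x, p))))
    exact measurable_const.inner this
  have hW : ∀ x p, ‖x‖ ≤ B → ‖p‖ ≤ B → WBound V (L * ‖x - x₀‖) (f x p) := fun x p hx hp =>
    ⟨hfm x p, fun w => (abs_real_inner_le_norm _ _).trans (by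
      have := mul_le_mul_of_nonneg_left (hF.growth w x p hx hp) (norm_nonneg (x - x₀))
      linarith)⟩
  have hlip : ∀ x p x' p', ‖x‖ ≤ B → ‖p‖ ≤ B → ‖x'‖ ≤ B → ‖p'‖ ≤ B →
      WBound V (L * (1 + 2 * B) * (‖x - x'‖ + ‖p - p'‖)) fun w => f x p w - f x' p' w := by
    intro x p x' p' hx hp hx' hp'
    refine ⟨(hfm x p).sub (hfm x' p'), fun w => ?_⟩
    have h1 : f x p w - f x' p' w =
        inner ℝ (x - x') (F w x p) + inner ℝ (x' - x₀) (F w x p - F w x' p') := by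
      simp only [hf, inner_sub_left, inner_sub_right]
      ring
    have h2 : ‖x' - x₀‖ ≤ 2 * B := (norm_sub_le _ _).trans (by linarith)
    have h3 := (abs_real_inner_le_norm (x - x') (F w x p)).trans
      (mul_le_mul_of_nonneg_left (hF.growth w x p hx hp) (norm_nonneg _))
    have h4 := (abs_real_inner_le_norm (x' - x₀) (F w x p - F w x' p')).trans
      (mul_le_mul h2 (hF.lipschitz w x p x' p' hx hp hx' hp') (norm_nonneg _) (by positivity))
    rw [h1]
    refine (abs_add_le _ _).trans ((add_le_add h3 h4).trans ?_)
    have h5 : 0 ≤ L * V w * ‖p - p'‖ := mul_nonneg (mul_nonneg hL (hV0 w)) (norm_nonneg _)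
    nlinarith
  have hΓlip : ∀ x p x' p', ‖x‖ ≤ B → ‖p‖ ≤ B → ‖x'‖ ≤ B → ‖p'‖ ≤ B → ∀ w,
      |Γ (f x p) w - Γ (f x' p') w| ≤
        c * (L * (1 + 2 * B) * (‖x - x'‖ + ‖p - p'‖)) * V w := by
    intro x p x' p' hx hp hx' hp' w
    rw [← hΓ.sub _ _ _ _ (by positivity) (by positivity) (hW x p hx hp) (hW x' p' hx' hp')]
    exact (hΓ.bound _ _ (by positivity) (hlip x p x' p' hx hp hx' hp')).bound w
  have hπ : ∀ {k : ℕ} {x : Vec k}, ‖x‖ ≤ B → ballProj B x = x := fun h => ballProj_of_norm_le h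
  -- Projecting the parameters changes nothing in the ball and makes `g` Lipschitz in all
  -- parameters. Together with measurability in the state this yields joint measurability (a
  -- Carathéodory function), which the solver alone does not provide.
  set g : Vec d → Vec dp → S → ℝ := fun x p => Γ (f (ballProj B x) (ballProj B p)) with hg
  refine ⟨c * (L * (1 + 2 * B)), g, by positivity, ?_, fun x p hx hp w => ?_,
    fun x p x' p' hx hp hx' hp' w => ?_, fun x p hx hp w => ?_⟩
  · refine measurable_uncurry_of_continuous_of_measurable
      (u := fun (q : Vec d × Vec dp) (w : S) => g q.1 q.2 w) (fun w => ?_) fun q => ?_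
    · have hlipq : ∀ q q' : Vec d × Vec dp, |g q.1 q.2 w - g q'.1 q'.2 w| ≤
          c * (L * (1 + 2 * B)) * V w * 2 * dist q q' := fun q q' => by
        have h1 := hΓlip (ballProj B q.1) (ballProj B q.2) (ballProj B q'.1) (ballProj B q'.2)
          (norm_ballProj_le hB _) (norm_ballProj_le hB _) (norm_ballProj_le hB _)
          (norm_ballProj_le hB _) w
        have h2 : ‖ballProj B q.1 - ballProj B q'.1‖ ≤ dist q q' :=
          (norm_ballProj_sub_le hB _ _).trans (by
            rw [← dist_eq_norm]; exact le_max_left _ _)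
        have h3 : ‖ballProj B q.2 - ballProj B q'.2‖ ≤ dist q q' :=
          (norm_ballProj_sub_le hB _ _).trans (by
            rw [← dist_eq_norm]; exact le_max_right _ _)
        have h4 : 0 ≤ c * (L * (1 + 2 * B)) * V w := mul_nonneg (by positivity) (hV0 w)
        refine h1.trans ?_
        have := mul_le_mul_of_nonneg_left (add_le_add h2 h3) h4
        linarith
      refine (LipschitzWith.of_dist_le_mul
        (K := Real.toNNReal (c * (L * (1 + 2 * B)) * V w * 2)) fun q q' => ?_).continuous
      rw [Real.coe_toNNReal _ (mul_nonneg (mul_nonneg (by positivity) (hV0 w)) zero_le_two),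
        Real.dist_eq]
      exact hlipq q q'
    · exact (hΓ.bound _ _ (by positivity)
        (hW _ _ (norm_ballProj_le hB _) (norm_ballProj_le hB _))).measurable
  · simp only [hg, hπ hx, hπ hp]
    refine ((hΓ.bound _ _ (by positivity) (hW x p hx hp)).bound w).trans ?_
    have h4 : 0 ≤ c * L * ‖x - x₀‖ * V w * (2 * B) :=
      mul_nonneg (mul_nonneg (by positivity) (hV0 w)) (by positivity)
    nlinarith
  · simp only [hg, hπ hx, hπ hp, hπ hx', hπ hp']
    refine (hΓlip x p x' p' hx hp hx' hp' w).trans (le_of_eq (by ring))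
  · simp only [hg, hπ hx, hπ hp]
    exact hΓ.equation _ _ (by positivity) (hW x p hx hp) w

end Corrector

/-! ### The perturbed Lyapunov function -/

/-- The algebra behind one step of the perturbed Lyapunov function. -/
lemma perturbed_step {n n' v v' q a a' g₁ g₂ g₃ A ft fb ζ L L' D c ca a₀ B : ℝ}
    (hζ : 0 < ζ) (hL : 0 ≤ L) (hL' : 0 ≤ L') (hc : 0 ≤ c) (hca : 0 ≤ ca) (hB : 0 ≤ B)
    (ha : 0 ≤ a) (ha' : 0 ≤ a') (haa' : a' ≤ a) (haca : a - a' ≤ ca * a ^ 2) (haa₀ : a ≤ a₀)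
    (hv : 1 ≤ v) (hv' : 1 ≤ v') (hn'B : n' ≤ 2 * B)
    (h1 : n' ^ 2 ≤ n ^ 2 + 2 * a * ft + a ^ 2 * (L * v) ^ 2)
    (h2 : g₁ - A = ft - fb) (h3 : fb ≤ -ζ * n ^ 2 + D * n * q)
    (h4 : |g₂| ≤ c * n' * v') (h5 : |g₂ - g₃| ≤ c * (a * (L * v) + L' * a * v) * v')
    (h6 : |g₁| ≤ c * n * v) :
    n' ^ 2 + 2 * a' * g₂ + 2 * c ^ 2 * a' ^ 2 * v' ^ 2 ≤
      (1 - ζ / 2 * a) * (n ^ 2 + 2 * a * g₁ + 2 * c ^ 2 * a ^ 2 * v ^ 2) + D ^ 2 / ζ * a * q ^ 2 +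
      (L ^ 2 + c * (L + L') + 4 * B * c * ca + 2 * c ^ 2 + ζ / 2 * a₀ * (3 * c ^ 2)) * a ^ 2 *
        (v ^ 2 + v' ^ 2) + 2 * a * (g₃ - A) := by
  -- Young's inequality, balanced so that the parameter error consumes half of the available `2 ζ a
  -- n²`.
  have e1 : 2 * a * (D * n * q) ≤ ζ * a * n ^ 2 + D ^ 2 / ζ * a * q ^ 2 := by
    have : ζ * a * n ^ 2 + D ^ 2 / ζ * a * q ^ 2 - 2 * a * (D * n * q) =
        a / ζ * (ζ * n - D * q) ^ 2 := by field_simp; ring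
    have : 0 ≤ a / ζ * (ζ * n - D * q) ^ 2 := by positivity
    linarith
  have e2 : 2 * a * fb ≤ -ζ * a * n ^ 2 + D ^ 2 / ζ * a * q ^ 2 := by
    have := mul_le_mul_of_nonneg_left h3 (by positivity : 0 ≤ 2 * a)
    nlinarith
  have e3 : 2 * a * (g₂ - g₃) ≤ c * (L + L') * a ^ 2 * (v ^ 2 + v' ^ 2) := by
    calc 2 * a * (g₂ - g₃) ≤ 2 * a * (c * (a * (L * v) + L' * a * v) * v') :=
          mul_le_mul_of_nonneg_left ((le_abs_self _).trans h5) (by positivity)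
      _ = c * (L + L') * a ^ 2 * (2 * v * v') := by ring
      _ ≤ _ := mul_le_mul_of_nonneg_left (two_mul_le_add_sq v v') (by positivity)
  have e4 : -(2 * (a - a') * g₂) ≤ 4 * B * c * ca * a ^ 2 * v' ^ 2 := by
    have i1 : -g₂ ≤ c * (2 * B) * v' ^ 2 := by
      refine ((neg_le_abs _).trans h4).trans ?_
      have : v' ≤ v' ^ 2 := by nlinarith
      exact mul_le_mul (mul_le_mul_of_nonneg_left hn'B hc) this (by linarith) (by positivity)
    have i2 : 0 ≤ c * (2 * B) * v' ^ 2 := by positivity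
    calc -(2 * (a - a') * g₂) = 2 * (a - a') * -g₂ := by ring
      _ ≤ 2 * (a - a') * (c * (2 * B) * v' ^ 2) :=
        mul_le_mul_of_nonneg_left i1 (by linarith)
      _ ≤ 2 * (ca * a ^ 2) * (c * (2 * B) * v' ^ 2) :=
        mul_le_mul_of_nonneg_right (by linarith) i2
      _ = _ := by ring
  have e5 : 2 * c ^ 2 * a' ^ 2 * v' ^ 2 ≤ 2 * c ^ 2 * a ^ 2 * v' ^ 2 := by
    have : a' ^ 2 ≤ a ^ 2 := by nlinarith
    gcongr
  -- The remaining `ζ a n²` must be expressed through the perturbed function; since the latter is at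
  -- most `2 n²` up to `O(a²)`, the rate becomes `ζ / 2`.
  have e6 : n ^ 2 + 2 * a * g₁ + 2 * c ^ 2 * a ^ 2 * v ^ 2 ≤
      2 * n ^ 2 + 3 * c ^ 2 * a ^ 2 * v ^ 2 := by
    have := mul_le_mul_of_nonneg_left ((le_abs_self _).trans h6) (by positivity : 0 ≤ 2 * a)
    linarith [sq_nonneg (n - c * a * v)]
  have e7 := mul_le_mul_of_nonneg_left e6 (by positivity : 0 ≤ ζ / 2 * a)
  have e8 : ζ / 2 * a * (3 * c ^ 2 * a ^ 2 * v ^ 2) ≤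
      ζ / 2 * a₀ * (3 * c ^ 2) * a ^ 2 * v ^ 2 := by
    have : 0 ≤ ζ / 2 * (3 * c ^ 2 * a ^ 2 * v ^ 2) := by positivity
    linarith [mul_le_mul_of_nonneg_left haa₀ this]
  have p1 : 0 ≤ L ^ 2 * a ^ 2 * v' ^ 2 := by positivity
  have p2 : 0 ≤ 4 * B * c * ca * a ^ 2 * v ^ 2 := by positivity
  have p3 : 0 ≤ 2 * c ^ 2 * a ^ 2 * v ^ 2 := by positivity
  have p4 : 0 ≤ ζ / 2 * a₀ * (3 * c ^ 2) * a ^ 2 * v' ^ 2 := by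
    have : 0 ≤ a₀ := ha.trans haa₀
    positivity
  have k1 : 2 * a * ft = 2 * a * fb + 2 * a * (g₁ - A) := by rw [h2]; ring
  linarith

section OneStep

variable {m d dp : ℕ} {S : Set (Vec m)} {P : Kernel S S} [IsMarkovKernel P]
  {ν : Measure S} [IsProbabilityMeasure ν] {V : S → ℝ} {B L : ℝ}

/-- One component of the projected recursion: `x` is driven by the field `F` with step sizes `a`,
and the slowly varying parameter `p` is exogenous. -/
structure IsDrivenBy {Ω : Type*} [mΩ : MeasurableSpace Ω] (F : S → Vec d → Vec dp → Vec d)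
    (V : S → ℝ) (B L' : ℝ) (a : ℕ → ℝ) (ℱ : Filtration ℕ mΩ) (W : ℕ → Ω → S)
    (x : ℕ → Ω → Vec d) (p : ℕ → Ω → Vec dp) : Prop where
  measurable_x : ∀ t, Measurable[ℱ t] (x t)
  measurable_p : ∀ t, Measurable[ℱ t] (p t)
  succ : ∀ t ω, x (t + 1) ω = ballProj B (x t ω + a t • F (W t ω) (x t ω) (p t ω))
  -- Only from time `1`: the initial values may lie outside the ball, and the first projection
  -- brings them in.
  norm_x : ∀ t ω, 1 ≤ t → ‖x t ω‖ ≤ B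
  norm_p : ∀ t ω, 1 ≤ t → ‖p t ω‖ ≤ B
  p_succ : ∀ t ω, 1 ≤ t → ‖p (t + 1) ω - p t ω‖ ≤ L' * a t * V (W t ω)

/-- The perturbed Lyapunov function of one component of the recursion. -/
structure IsLyapunovProcess {Ω : Type*} [mΩ : MeasurableSpace Ω] (μ : Measure Ω) (V : S → ℝ)
    (r c : ℝ) (a : ℕ → ℝ) (ℱ : Filtration ℕ mΩ) (W : ℕ → Ω → S) (n q : ℕ → Ω → ℝ)
    (Z : ℕ → Ω → ℝ) : Prop where
  measurable : ∀ t, Measurable[ℱ t] (Z t)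
  lower : ∀ t ω, 1 ≤ t → n t ω ^ 2 / 2 ≤ Z t ω
  upper : ∀ t ω, 1 ≤ t → Z t ω ≤ c * V (W t ω) ^ 2
  step : ∀ t E, 1 ≤ t → MeasurableSet[ℱ t] E → ∫ ω in E, Z (t + 1) ω ∂μ ≤
    (1 - r * a t) * ∫ ω in E, Z t ω ∂μ + c * a t * ∫ ω in E, q t ω ^ 2 ∂μ +
      c * a t ^ 2 * ∫ ω in E, V (W t ω) ^ 2 ∂μ

-- The constants are fixed before the probability space, so they are uniform over all realizations
-- of the recursion.
set_option maxHeartbeats 1000000 in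
theorem exists_lyapunovProcess {W₀ : Set S} {ρ b ρ₂ b₂ : ℝ} (hdV : HasDrift P V W₀ ρ b)
    (hdU : HasDrift P (fun w => V w ^ 2) W₀ ρ₂ b₂) (hνV : Integrable V ν)
    {c : ℝ} {Γ : (S → ℝ) → S → ℝ} (hΓ : IsPoissonSolver P ν V c Γ) (hB : 0 < B)
    {F : S → Vec d → Vec dp → Vec d} (hF : IsLipschitzField V B L F)
    {x₀ : Vec d} {p₀ : Vec dp} (hx₀ : ‖x₀‖ ≤ B) (hp₀ : ‖p₀‖ ≤ B) {ζ : ℝ} (hζ : 0 < ζ)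
    (hmono : ∀ x, ‖x‖ ≤ B → ∫ w, inner ℝ (x - x₀) (F w x p₀) ∂ν ≤ -ζ * ‖x - x₀‖ ^ 2)
    {a : ℕ → ℝ} {a₀ ca L' : ℝ} (ha : ∀ t, 0 ≤ a t) (hanti : ∀ t, a (t + 1) ≤ a t)
    (haa₀ : ∀ t, a t ≤ a₀) (hca : 0 ≤ ca)
    (hdiff : ∀ t, 1 ≤ t → a t - a (t + 1) ≤ ca * a t ^ 2) (hL' : 0 ≤ L') :
    ∃ r c : ℝ, 0 < r ∧ 0 < c ∧ ∀ {Ω : Type*} [mΩ : MeasurableSpace Ω] (μ : Measure Ω)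
      [IsProbabilityMeasure μ] (ℱ : Filtration ℕ mΩ) (w : S) (W : ℕ → Ω → S)
      (x : ℕ → Ω → Vec d) (p : ℕ → Ω → Vec dp), IsMarkovChainFrom P w μ ℱ W →
      IsDrivenBy F V B L' a ℱ W x p →
      ∃ Z, IsLyapunovProcess μ V r c a ℱ W (fun t ω => ‖x t ω - x₀‖) (fun t ω => ‖p t ω - p₀‖) Z := by
  have hV1 := hdV.one_le
  have hV0 : ∀ x, 0 ≤ V x := fun x => zero_le_one.trans (hV1 x)
  have hL := hF.nonneg
  obtain ⟨c₁, g, hg⟩ := hΓ.exists_corrector hV1 hB hF hx₀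
  have hc₁ := hg.nonneg
  set mV : ℝ := ∫ w, V w ∂ν with hmV
  have hmV0 : 0 ≤ mV := integral_nonneg hV0
  set D : ℝ := L * mV with hD
  have hFint : ∀ x p, ‖x‖ ≤ B → ‖p‖ ≤ B → Integrable (fun w => inner ℝ (x - x₀) (F w x p)) ν := by
    intro x p hx hp
    have hm : Measurable fun w => F w x p :=
      hF.measurable.comp (measurable_id.prodMk (measurable_const (a := (x, p))))
    refine (hνV.const_mul (‖x - x₀‖ * L)).mono' (measurable_const.inner hm).aestronglyMeasurable
      (ae_of_all _ fun w => (norm_inner_le_norm _ _).trans ?_)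
    rw [mul_assoc]
    exact mul_le_mul_of_nonneg_left (hF.growth w x p hx hp) (norm_nonneg _)
  have hmean : ∀ x p, ‖x‖ ≤ B → ‖p‖ ≤ B → ∫ w, inner ℝ (x - x₀) (F w x p) ∂ν ≤
      -ζ * ‖x - x₀‖ ^ 2 + D * ‖x - x₀‖ * ‖p - p₀‖ := by
    intro x p hx hp
    have h1 : ∫ w, (inner ℝ (x - x₀) (F w x p) - inner ℝ (x - x₀) (F w x p₀)) ∂ν ≤
        ∫ w, ‖x - x₀‖ * (L * ‖p - p₀‖) * V w ∂ν := by
      refine integral_mono ((hFint x p hx hp).sub (hFint x p₀ hx hp₀)) (hνV.const_mul _) fun w => ?_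
      simp only [← inner_sub_right]
      refine (real_inner_le_norm _ _).trans ?_
      have := hF.lipschitz w x p x p₀ hx hp hx hp₀
      rw [sub_self, norm_zero, zero_add] at this
      have := mul_le_mul_of_nonneg_left this (norm_nonneg (x - x₀))
      linarith
    rw [integral_sub (hFint x p hx hp) (hFint x p₀ hx hp₀), integral_const_mul] at h1
    have h2 := hmono x hx
    have h3 : ‖x - x₀‖ * (L * ‖p - p₀‖) * mV = D * ‖x - x₀‖ * ‖p - p₀‖ := by rw [hD]; ring
    linarith
  have ha₀ : 0 ≤ a₀ := (ha 0).trans (haa₀ 0)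
  set K : ℝ := L ^ 2 + c₁ * (L + L') + 4 * B * c₁ * ca + 2 * c₁ ^ 2 + ζ / 2 * a₀ * (3 * c₁ ^ 2)
    with hK
  have hK0 : 0 ≤ K := by positivity
  have hb₂ := hdU.b_pos
  obtain ⟨c₂, hc₂⟩ : ∃ c₂ : ℝ, c₂ = 1 + D ^ 2 / ζ + K * (2 + b₂) +
    (8 * B ^ 2 + 3 * c₁ ^ 2 * a₀ ^ 2) := ⟨_, rfl⟩
  have hc₂0 : 0 < c₂ := by rw [hc₂]; positivity
  refine ⟨ζ / 2, c₂, by positivity, hc₂0, fun {Ω} mΩ μ _ ℱ w W x p hW hD' => ?_⟩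
  -- The last term completes the square: `2 a |g| ≤ 2 a c₁ n V ≤ n² / 2 + 2 c₁² a² V²`, with `n = ‖x
  -- t ω - x₀‖`, keeps `Z` above `n² / 2`.
  obtain ⟨Z, hZ⟩ : ∃ Z : ℕ → Ω → ℝ, ∀ t ω, Z t ω = ‖x t ω - x₀‖ ^ 2 +
    2 * a t * g (x t ω) (p t ω) (W t ω) + 2 * c₁ ^ 2 * a t ^ 2 * V (W t ω) ^ 2 :=
    ⟨_, fun _ _ => rfl⟩
  have hθ : ∀ t, Measurable[ℱ t] fun ω => (x t ω, p t ω) := fun t =>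
    (hD'.measurable_x t).prodMk (hD'.measurable_p t)
  have hZm : ∀ t, Measurable[ℱ t] (Z t) := fun t => by
    have h1 : Measurable fun q : (Vec d × Vec dp) × S => ‖q.1.1 - x₀‖ ^ 2 +
        2 * a t * g q.1.1 q.1.2 q.2 + 2 * c₁ ^ 2 * a t ^ 2 * V q.2 ^ 2 := by
      have e1 : Measurable fun q : (Vec d × Vec dp) × S => ‖q.1.1 - x₀‖ := by fun_prop
      have e2 : Measurable fun q : (Vec d × Vec dp) × S => V q.2 :=
        hdV.measurable.comp measurable_snd
      exact ((e1.pow_const 2).add (hg.measurable.const_mul _)).add ((e2.pow_const 2).const_mul _)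
    have h2 := h1.comp ((hθ t).prodMk (hW.adapted t))
    have h3 : Z t = _ := funext (hZ t)
    rw [h3]
    exact h2
  have hnB : ∀ t ω, 1 ≤ t → ‖x t ω - x₀‖ ≤ 2 * B := fun t ω ht =>
    (norm_sub_le _ _).trans (by linarith [hD'.norm_x t ω ht])
  have hgb : ∀ t ω, 1 ≤ t → |g (x t ω) (p t ω) (W t ω)| ≤ c₁ * ‖x t ω - x₀‖ * V (W t ω) :=
    fun t ω ht => hg.bound _ _ (hD'.norm_x t ω ht) (hD'.norm_p t ω ht) _
  have hlow : ∀ t ω, 1 ≤ t → ‖x t ω - x₀‖ ^ 2 / 2 ≤ Z t ω := fun t ω ht => by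
    have h1 := mul_le_mul_of_nonneg_left ((neg_le_abs _).trans (hgb t ω ht))
      (mul_nonneg zero_le_two (ha t))
    rw [hZ]
    nlinarith [sq_nonneg (‖x t ω - x₀‖ - 2 * (c₁ * a t * V (W t ω)))]
  have hup : ∀ t ω, 1 ≤ t → Z t ω ≤ (8 * B ^ 2 + 3 * c₁ ^ 2 * a₀ ^ 2) * V (W t ω) ^ 2 :=
    fun t ω ht => by
    have h1 := mul_le_mul_of_nonneg_left ((le_abs_self _).trans (hgb t ω ht))
      (mul_nonneg zero_le_two (ha t))
    have h2 : ‖x t ω - x₀‖ ^ 2 ≤ 4 * B ^ 2 := by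
      nlinarith [hnB t ω ht, norm_nonneg (x t ω - x₀)]
    have h3 : a t ^ 2 ≤ a₀ ^ 2 := by nlinarith [ha t, haa₀ t]
    have h4 : 1 ≤ V (W t ω) ^ 2 := by nlinarith [hV1 (W t ω)]
    have h5 : c₁ ^ 2 * V (W t ω) ^ 2 * a t ^ 2 ≤ c₁ ^ 2 * V (W t ω) ^ 2 * a₀ ^ 2 := by gcongr
    have h6 : 8 * B ^ 2 * 1 ≤ 8 * B ^ 2 * V (W t ω) ^ 2 := by gcongr
    rw [hZ]
    nlinarith [sq_nonneg (‖x t ω - x₀‖ - c₁ * a t * V (W t ω))]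
  have hUint : ∀ t, Integrable (fun ω => V (W t ω) ^ 2) μ := fun t =>
    (hW.integrable_and_integral_le hdU t).1
  have hZint : ∀ t, 1 ≤ t → Integrable (Z t) μ := fun t ht =>
    ((hUint t).const_mul _).mono' ((hZm t).mono (ℱ.le t) le_rfl).aestronglyMeasurable
      (ae_of_all _ fun ω => by
        rw [Real.norm_of_nonneg ((by positivity : 0 ≤ ‖x t ω - x₀‖ ^ 2 / 2).trans (hlow t ω ht))]
        exact hup t ω ht)
  refine ⟨Z, hZm, hlow, fun t ω ht => (hup t ω ht).trans ?_, fun t E ht hE => ?_⟩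
  · refine mul_le_mul_of_nonneg_right ?_ (by positivity)
    have : 0 ≤ 1 + D ^ 2 / ζ + K * (2 + b₂) := by positivity
    linarith
  set G₃ : Ω → ℝ := fun ω => g (x t ω) (p t ω) (W (t + 1) ω) with hG₃
  set A : Ω → ℝ := fun ω => avg P (g (x t ω) (p t ω)) (W t ω) with hA
  have hVint : ∀ s, Integrable (fun ω => V (W s ω)) μ := fun s =>
    (hW.integrable_and_integral_le hdV s).1
  have hθ' : Measurable fun ω => (x t ω, p t ω) := (hθ t).mono (ℱ.le t) le_rfl
  have hG₃m : Measurable G₃ := hg.measurable.comp (hθ'.prodMk (hW.measurable (t + 1)))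
  have hbB : ∀ ω y, |g (x t ω) (p t ω) y| ≤ c₁ * (2 * B) * V y := fun ω y =>
    (hg.bound _ _ (hD'.norm_x t ω ht) (hD'.norm_p t ω ht) y).trans (by
      have := hnB t ω ht
      have := hV0 y
      gcongr)
  have hG₃int : Integrable G₃ μ :=
    ((hVint (t + 1)).const_mul (c₁ * (2 * B))).mono' hG₃m.aestronglyMeasurable
      (ae_of_all _ fun ω => hbB ω _)
  have hAm : Measurable A := by
    have h1 : Measurable fun q : ((Vec d × Vec dp) × S) × S => g q.1.1.1 q.1.1.2 q.2 :=
      hg.measurable.comp ((measurable_fst.comp measurable_fst).prodMk measurable_snd)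
    have h2 := (h1.stronglyMeasurable.integral_kernel_prod_right'
      (κ := Kernel.prodMkLeft (Vec d × Vec dp) P)).measurable
    exact h2.comp (hθ'.prodMk (hW.measurable t))
  have hAint : Integrable A μ := by
    refine ((hVint t).const_mul (c₁ * (2 * B) * (1 + b))).mono' hAm.aestronglyMeasurable
      (ae_of_all _ fun ω => ?_)
    have hgω : WBound V (c₁ * (2 * B)) (g (x t ω) (p t ω)) :=
      ⟨hg.measurable.comp (measurable_const.prodMk measurable_id :
        Measurable fun y : S => ((x t ω, p t ω), y)), hbB ω⟩
    refine (hgω.abs_integral_le (hdV.integrable (W t ω))).trans ?_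
    rw [mul_assoc (c₁ * (2 * B))]
    refine mul_le_mul_of_nonneg_left ?_ (by positivity)
    have h2 : W₀.indicator (fun _ => b) (W t ω) ≤ b :=
      Set.indicator_le_self' (fun _ _ => hdV.b_pos.le) _
    nlinarith [hdV.le (W t ω), hV1 (W t ω), hdV.rho_lt, hdV.b_pos]
  -- The noise cancels here: the old parameters `x t`, `p t` are frozen, so the Markov property
  -- applies to the new state.
  have hmart : ∫ ω in E, G₃ ω ∂μ = ∫ ω in E, A ω ∂μ :=
    hW.setIntegral_eq t (Y := fun ω => (x t ω, p t ω)) (hθ t) hE (g := fun q => g q.1.1 q.1.2 q.2) hg.measurable hG₃int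
  have hqm : Measurable fun ω => ‖p t ω - p₀‖ ^ 2 :=
    ((((hD'.measurable_p t).mono (ℱ.le t) le_rfl).sub_const p₀).norm).pow_const 2
  have hqint : Integrable (fun ω => ‖p t ω - p₀‖ ^ 2) μ :=
    (integrable_const ((2 * B) ^ 2)).mono' hqm.aestronglyMeasurable (ae_of_all _ fun ω => by
      rw [Real.norm_of_nonneg (by positivity)]
      have : ‖p t ω - p₀‖ ≤ 2 * B :=
        (norm_sub_le _ _).trans (by linarith [hD'.norm_p t ω ht])
      gcongr)
  have hpath : ∀ ω, Z (t + 1) ω ≤ (1 - ζ / 2 * a t) * Z t ω +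
      D ^ 2 / ζ * a t * ‖p t ω - p₀‖ ^ 2 +
      K * a t ^ 2 * (V (W t ω) ^ 2 + V (W (t + 1) ω) ^ 2) + 2 * a t * (G₃ ω - A ω) := by
    intro ω
    have hxB := hD'.norm_x t ω ht
    have hpB := hD'.norm_p t ω ht
    have hxB' := hD'.norm_x (t + 1) ω (by omega)
    have hpB' := hD'.norm_p (t + 1) ω (by omega)
    have hgr := hF.growth (W t ω) _ _ hxB hpB
    have hsq : ‖F (W t ω) (x t ω) (p t ω)‖ ^ 2 ≤ (L * V (W t ω)) ^ 2 := by gcongr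
    rw [hZ, hZ]
    refine perturbed_step (n := ‖x t ω - x₀‖) (n' := ‖x (t + 1) ω - x₀‖) (L := L) (L' := L')
      (ft := inner ℝ (x t ω - x₀) (F (W t ω) (x t ω) (p t ω))) (B := B)
      (fb := ∫ y, inner ℝ (x t ω - x₀) (F y (x t ω) (p t ω)) ∂ν) hζ hL hL' hc₁ hca hB.le
      (ha t) (ha (t + 1)) (hanti t) (hdiff t ht) (haa₀ t) (hV1 _) (hV1 _)
      (hnB (t + 1) ω (by omega)) ?_ (hg.equation _ _ hxB hpB _) (hmean _ _ hxB hpB)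
      (hgb (t + 1) ω (by omega)) ?_ (hgb t ω ht)
    · rw [hD'.succ]
      have h1 := norm_ballProj_sub_le_of_norm_le hB
        (x t ω + a t • F (W t ω) (x t ω) (p t ω)) hx₀
      have h2 : x t ω + a t • F (W t ω) (x t ω) (p t ω) - x₀ =
          (x t ω - x₀) + a t • F (W t ω) (x t ω) (p t ω) := by abel
      rw [h2] at h1
      have h3 := norm_add_sq_real (x t ω - x₀) (a t • F (W t ω) (x t ω) (p t ω))
      rw [inner_smul_right, norm_smul, Real.norm_of_nonneg (ha t), mul_pow] at h3
      have h4 := pow_le_pow_left₀ (norm_nonneg _) h1 2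
      have h5 := mul_le_mul_of_nonneg_left hsq (sq_nonneg (a t))
      linarith
    · refine (hg.lipschitz _ _ _ _ hxB' hpB' hxB hpB (W (t + 1) ω)).trans ?_
      refine mul_le_mul_of_nonneg_right (mul_le_mul_of_nonneg_left (add_le_add ?_ ?_) hc₁) (hV0 _)
      · rw [hD'.succ]
        refine (norm_ballProj_sub_le_of_norm_le hB _ hxB).trans ?_
        rw [add_sub_cancel_left, norm_smul, Real.norm_of_nonneg (ha t)]
        exact mul_le_mul_of_nonneg_left hgr (ha t)
      · exact hD'.p_succ t ω ht
  have i1 := ((hZint t ht).const_mul (1 - ζ / 2 * a t)).integrableOn (s := E)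
  have i2 := (hqint.const_mul (D ^ 2 / ζ * a t)).integrableOn (s := E)
  have i3 : IntegrableOn (fun ω => K * a t ^ 2 * (V (W t ω) ^ 2 + V (W (t + 1) ω) ^ 2)) E μ :=
    (((hUint t).add (hUint (t + 1))).const_mul (K * a t ^ 2)).integrableOn
  have i4 : IntegrableOn (fun ω => 2 * a t * (G₃ ω - A ω)) E μ :=
    ((hG₃int.sub hAint).const_mul (2 * a t)).integrableOn
  have i12 : IntegrableOn (fun ω => (1 - ζ / 2 * a t) * Z t ω +
    D ^ 2 / ζ * a t * ‖p t ω - p₀‖ ^ 2) E μ := i1.add i2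
  have i123 : IntegrableOn (fun ω => (1 - ζ / 2 * a t) * Z t ω +
    D ^ 2 / ζ * a t * ‖p t ω - p₀‖ ^ 2 +
    K * a t ^ 2 * (V (W t ω) ^ 2 + V (W (t + 1) ω) ^ 2)) E μ := i12.add i3
  have hmain := integral_mono (hZint (t + 1) (by omega)).integrableOn (i123.add i4) hpath
  simp only [Pi.add_apply] at hmain
  rw [integral_add i123 i4, integral_add i12 i3, integral_add i1 i2,
    integral_const_mul, integral_const_mul, integral_const_mul, integral_const_mul,
    integral_sub hG₃int.integrableOn hAint.integrableOn, hmart, sub_self, mul_zero, add_zero,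
    integral_add (hUint t).integrableOn (hUint (t + 1)).integrableOn] at hmain
  have hUle := hW.setIntegral_le hdU t hE
  have hU0 : 0 ≤ ∫ ω in E, V (W t ω) ^ 2 ∂μ := integral_nonneg fun ω => by positivity
  have hq0 : 0 ≤ ∫ ω in E, ‖p t ω - p₀‖ ^ 2 ∂μ := integral_nonneg fun ω => by positivity
  have f1 : D ^ 2 / ζ * a t * ∫ ω in E, ‖p t ω - p₀‖ ^ 2 ∂μ ≤
      c₂ * a t * ∫ ω in E, ‖p t ω - p₀‖ ^ 2 ∂μ := by
    refine mul_le_mul_of_nonneg_right (mul_le_mul_of_nonneg_right ?_ (ha t)) hq0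
    have : 0 ≤ 1 + K * (2 + b₂) + (8 * B ^ 2 + 3 * c₁ ^ 2 * a₀ ^ 2) := by positivity
    linarith
  have f2 : K * a t ^ 2 * (∫ ω in E, V (W t ω) ^ 2 ∂μ + ∫ ω in E, V (W (t + 1) ω) ^ 2 ∂μ) ≤
      c₂ * a t ^ 2 * ∫ ω in E, V (W t ω) ^ 2 ∂μ := by
    calc _ ≤ K * a t ^ 2 * ((2 + b₂) * ∫ ω in E, V (W t ω) ^ 2 ∂μ) := by
          refine mul_le_mul_of_nonneg_left ?_ (by positivity)
          linarith
      _ = K * (2 + b₂) * (a t ^ 2 * ∫ ω in E, V (W t ω) ^ 2 ∂μ) := by ring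
      _ ≤ c₂ * (a t ^ 2 * ∫ ω in E, V (W t ω) ^ 2 ∂μ) := by
          refine mul_le_mul_of_nonneg_right ?_ (by positivity)
          have : 0 ≤ 1 + D ^ 2 / ζ + (8 * B ^ 2 + 3 * c₁ ^ 2 * a₀ ^ 2) := by positivity
          linarith
      _ = _ := by ring
  linarith

end OneStep

/-! ### Increments of powers -/

section Rpow

variable {b t : ℝ}

lemma rpow_neg_add_one_ge (hb : 0 ≤ b) (hb1 : b ≤ 1) (ht : 1 ≤ t) :
    t ^ (-b) * (1 - b / t) ≤ (t + 1) ^ (-b) := by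
  have ht0 : 0 < t := by linarith
  have h1 : t + 1 = t * (1 + t⁻¹) := by field_simp
  have hu : 0 < 1 + t⁻¹ := by positivity
  rw [h1, Real.mul_rpow ht0.le hu.le]
  refine mul_le_mul_of_nonneg_left ?_ (by positivity)
  have h2 : (1 + t⁻¹) ^ b ≤ 1 + b * t⁻¹ :=
    rpow_one_add_le_one_add_mul_self (by linarith [inv_pos.2 ht0]) hb hb1
  rw [Real.rpow_neg hu.le, ← one_div, le_div_iff₀ (by positivity), div_eq_mul_inv]
  have hx : 0 ≤ b * t⁻¹ := by positivity
  rcases le_total (1 - b * t⁻¹) 0 with h | h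
  · exact (mul_nonpos_of_nonpos_of_nonneg h (by positivity)).trans zero_le_one
  · nlinarith

/-- Dominates the errors `t^(-1-b)` by a telescoping difference, so that their tail sum is
`O(T^(-b))`. -/
lemma rpow_neg_add_one_le (hb : 0 ≤ b) (hb1 : b ≤ 1) (ht : 1 ≤ t) :
    b / 4 * t ^ (-1 - b) ≤ t ^ (-b) - (t + 1) ^ (-b) := by
  have ht0 : 0 < t := by linarith
  have h1 : t + 1 = t * (1 + t⁻¹) := by field_simp
  have hu : 0 < 1 + t⁻¹ := by positivity
  have hlog : (2 * t)⁻¹ ≤ Real.log (1 + t⁻¹) := by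
    refine le_trans ?_ (Real.one_sub_inv_le_log_of_pos hu)
    have h2 : 1 - (1 + t⁻¹)⁻¹ = (t + 1)⁻¹ := by field_simp; ring
    rw [h2]
    exact inv_anti₀ (by positivity) (by linarith)
  set y := b * (2 * t)⁻¹ with hy
  have hy0 : 0 ≤ y := by positivity
  have hy1 : y ≤ 1 := by
    have : (2 * t)⁻¹ ≤ 1 := inv_le_one_of_one_le₀ (by linarith)
    exact mul_le_one₀ hb1 (by positivity) this
  have hpow : (1 + t⁻¹) ^ (-b) ≤ 1 - y / 2 := by
    rw [Real.rpow_def_of_pos hu]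
    have h3 : Real.exp (Real.log (1 + t⁻¹) * -b) ≤ Real.exp (-y) :=
      Real.exp_le_exp.2 (by nlinarith)
    refine h3.trans ?_
    rw [Real.exp_neg]
    refine (inv_anti₀ (by positivity) (Real.add_one_le_exp y)).trans ?_
    rw [← one_div, div_le_iff₀ (by positivity)]
    nlinarith
  rw [h1, Real.mul_rpow ht0.le hu.le]
  have h4 : b / 4 * t ^ (-1 - b) = t ^ (-b) * (y / 2) := by
    rw [show -1 - b = -b - 1 by ring, Real.rpow_sub_one ht0.ne', hy]
    field_simp
    ring
  rw [h4]
  have := mul_le_mul_of_nonneg_left hpow (Real.rpow_nonneg ht0.le (-b))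
  linarith

lemma add_one_rpow_le {s : ℝ} (hs1 : s ≤ 1) (ht : 0 < t) :
    (t + 1) ^ s ≤ (1 + t⁻¹) * t ^ s := by
  have h1 : t + 1 = t * (1 + t⁻¹) := by field_simp
  have hu : 1 ≤ 1 + t⁻¹ := by linarith [inv_pos.2 ht]
  rw [h1, Real.mul_rpow ht.le (by positivity), mul_comm]
  refine mul_le_mul_of_nonneg_right ?_ (by positivity)
  simpa using Real.rpow_le_rpow_of_exponent_le hu hs1

lemma eventually_div_le_mul_rpow_neg {e p : ℝ} (he : 0 < e) (hp : p < 1) (k : ℝ) :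
    ∀ᶠ n : ℕ in atTop, k / (n : ℝ) ≤ e * (n : ℝ) ^ (-p) := by
  have h1 : Tendsto (fun n : ℕ => (n : ℝ) ^ (1 - p)) atTop atTop :=
    (tendsto_rpow_atTop (by linarith)).comp tendsto_natCast_atTop_atTop
  filter_upwards [h1.eventually_ge_atTop (k / e), eventually_ge_atTop 1] with n hn hn1
  have hn0 : (0 : ℝ) < n := by exact_mod_cast hn1
  rw [div_le_iff₀ hn0, mul_assoc, ← Real.rpow_add_one hn0.ne', show -p + 1 = 1 - p by ring]
  rwa [div_le_iff₀' he] at hn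

end Rpow

/-! ### Maximal inequality and polynomial tails -/

section Maximal

variable {Ω : Type*} [mΩ : MeasurableSpace Ω] {μ : Measure Ω} [IsProbabilityMeasure μ]
  {ℱ : Filtration ℕ mΩ} {D : ℕ → Ω → ℝ} {b c η : ℝ} {t₁ : ℕ}

lemma measurableSet_forall_lt (hD : ∀ t, Measurable[ℱ t] (D t)) (T n : ℕ) {k : ℕ}
    (hk : T + n ≤ k + 1) : MeasurableSet[ℱ k] {ω | ∀ j < n, D (T + j) ω ≤ η} := by
  have : {ω | ∀ j < n, D (T + j) ω ≤ η} = ⋂ j, ⋂ (_ : j < n), {ω | D (T + j) ω ≤ η} := by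
    ext ω; simp
  rw [this]
  refine MeasurableSet.iInter fun j => MeasurableSet.iInter fun hj => ?_
  exact ((hD (T + j)).mono (ℱ.mono (by omega)) le_rfl) measurableSet_Iic

/-- Maximal inequality for nonnegative processes that are supermartingales up to a summable
error. -/
lemma le_measureReal_forall_lt (hb : 0 < b) (hb1 : b ≤ 1) (hc : 0 ≤ c) (ht₁ : 2 ≤ t₁)
    (hD : ∀ t, Measurable[ℱ t] (D t)) (hD0 : ∀ t, t₁ ≤ t → ∀ ω, 0 ≤ D t ω)
    (hint : ∀ t, t₁ ≤ t → Integrable (D t) μ)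
    (hstep : ∀ t E, t₁ ≤ t → MeasurableSet[ℱ t] E → ∫ ω in E, D (t + 1) ω ∂μ ≤
      (1 - 2 / (t : ℝ)) * ∫ ω in E, D t ω ∂μ + c * (t : ℝ) ^ (-1 - b))
    {T : ℕ} (hT : t₁ ≤ T) (n : ℕ) :
    η * (1 - μ.real {ω | ∀ j < n, D (T + j) ω ≤ η}) +
      ∫ ω in {ω | ∀ j < n, D (T + j) ω ≤ η}, D (T + n) ω ∂μ ≤
    ∫ ω, D T ω ∂μ + 4 * c / b * ((T : ℝ) ^ (-b) - ((T + n : ℕ) : ℝ) ^ (-b)) := by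
  induction n with
  | zero => simp
  | succ n ih =>
    set G := {ω | ∀ j < n, D (T + j) ω ≤ η} with hG
    set G' := {ω | ∀ j < n + 1, D (T + j) ω ≤ η} with hG'
    have hsub : G' ⊆ G := fun ω hω j hj => hω j (by omega)
    have hGm' : MeasurableSet[ℱ (T + n)] G' := measurableSet_forall_lt hD T (n + 1) (by omega)
    have hGm : MeasurableSet[ℱ (T + n)] G := measurableSet_forall_lt hD T n (by omega)
    have hm' := ℱ.le _ _ hGm'
    have hm := ℱ.le _ _ hGm
    have hi := hint (T + n) (by omega)
    -- On `G \ G'` the level is exceeded for the first time at `T + n`, so `D` is above `η` there.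
    -- This mass is banked; only `G'`, known at time `T + n`, is continued.
    have h1 : ∫ ω in G', D (T + n) ω ∂μ + η * (μ.real G - μ.real G') ≤
        ∫ ω in G, D (T + n) ω ∂μ := by
      have e1 : ∫ ω in G, D (T + n) ω ∂μ =
          ∫ ω in G', D (T + n) ω ∂μ + ∫ ω in G \ G', D (T + n) ω ∂μ := by
        rw [← setIntegral_union Set.disjoint_sdiff_right (hm.diff hm') hi.integrableOn
          hi.integrableOn, Set.union_sdiff_cancel hsub]
      have e2 : η * μ.real (G \ G') ≤ ∫ ω in G \ G', D (T + n) ω ∂μ := by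
        refine setIntegral_ge_of_const_le_real (hm.diff hm') (measure_ne_top _ _)
          (fun ω hω => ?_) hi.integrableOn
        by_contra hlt
        refine hω.2 fun j hj => ?_
        rcases Nat.lt_succ_iff_lt_or_eq.1 hj with hj | rfl
        · exact hω.1 j hj
        · exact (not_le.1 hlt).le
      rw [measureReal_sdiff hsub hm'] at e2
      linarith
    have h2 := hstep (T + n) G' (by omega) hGm'
    have hpos : 0 ≤ ∫ ω in G', D (T + n) ω ∂μ := integral_nonneg (hD0 _ (by omega))
    have h3 : (0 : ℝ) ≤ 2 / ((T + n : ℕ) : ℝ) := by positivity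
    have h4 := rpow_neg_add_one_le hb.le hb1 (t := ((T + n : ℕ) : ℝ))
      (by exact_mod_cast (by omega : 1 ≤ T + n))
    have h5 : c * ((T + n : ℕ) : ℝ) ^ (-1 - b) ≤
        4 * c / b * (((T + n : ℕ) : ℝ) ^ (-b) - (((T + n : ℕ) : ℝ) + 1) ^ (-b)) := by
      have := mul_le_mul_of_nonneg_left h4 (by positivity : 0 ≤ 4 * c / b)
      refine le_trans (le_of_eq ?_) this
      field_simp
    have h6 : ((T + (n + 1) : ℕ) : ℝ) = ((T + n : ℕ) : ℝ) + 1 := by push_cast; ring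
    rw [h6]
    have h7 : T + (n + 1) = T + n + 1 := by omega
    rw [h7]
    nlinarith

end Maximal

/-- Polynomial tail bound for a nonnegative process with contraction factor `1 - 2 / t` and
error `t ^ (-1 - b)`. The constants do not depend on the process. -/
theorem exists_tail_bound {b c η : ℝ} (hb : 0 < b) (hb1 : b ≤ 1) (hc : 0 ≤ c) (hη : 0 < η)
    {t₁ : ℕ} (ht₁ : 2 ≤ t₁) (M : ℝ) :
    ∃ K : ℝ, 0 < K ∧ ∀ {Ω : Type*} [mΩ : MeasurableSpace Ω] (μ : Measure Ω)
      [IsProbabilityMeasure μ] (ℱ : Filtration ℕ mΩ) (D : ℕ → Ω → ℝ),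
      (∀ t, Measurable[ℱ t] (D t)) → (∀ t, t₁ ≤ t → ∀ ω, 0 ≤ D t ω) →
      (∀ t, t₁ ≤ t → Integrable (D t) μ) → ∫ ω, D t₁ ω ∂μ ≤ M →
      (∀ t E, t₁ ≤ t → MeasurableSet[ℱ t] E → ∫ ω in E, D (t + 1) ω ∂μ ≤
        (1 - 2 / (t : ℝ)) * ∫ ω in E, D t ω ∂μ + c * (t : ℝ) ^ (-1 - b)) →
      ∀ T, t₁ ≤ T → 1 - K * (T : ℝ) ^ (-b) ≤ μ.real {ω | ∀ t, T ≤ t → D t ω ≤ η} := by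
  -- The first entry starts the induction for `E D_t ≤ C t^(-b)`; the second lets one of the two
  -- units in `2 / t` absorb the error. The other unit covers the decrease of `t^(-b)`, as `b ≤ 1`.
  set C : ℝ := max (M * (t₁ : ℝ) ^ b) (c + 1) with hC
  have hC0 : 0 < C := lt_of_lt_of_le (by linarith) (le_max_right _ _)
  refine ⟨(C + 4 * c / b) / η, by positivity, fun {Ω} mΩ μ _ ℱ D hD hD0 hint hM hstep T hT => ?_⟩
  have hmean : ∀ t, t₁ ≤ t → ∫ ω, D t ω ∂μ ≤ C * (t : ℝ) ^ (-b) := by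
    intro t ht
    induction t, ht using Nat.le_induction with
    | base =>
      refine hM.trans ?_
      have ht0 : (0 : ℝ) < t₁ := by exact_mod_cast (by omega : 0 < t₁)
      rw [Real.rpow_neg ht0.le, ← div_eq_mul_inv, le_div_iff₀ (by positivity)]
      exact le_max_left _ _
    | succ t ht ih =>
      have ht2 : (2 : ℝ) ≤ t := by exact_mod_cast ht₁.trans ht
      have ht0 : (0 : ℝ) < t := by linarith
      have h1 := hstep t Set.univ ht MeasurableSet.univ
      simp only [Measure.restrict_univ] at h1
      have h2 : (0 : ℝ) ≤ 1 - 2 / t := by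
        rw [sub_nonneg, div_le_one ht0]; exact ht2
      have h3 := mul_le_mul_of_nonneg_left ih h2
      have h4 := mul_le_mul_of_nonneg_left
        (rpow_neg_add_one_ge hb.le hb1 (by linarith : (1 : ℝ) ≤ t)) hC0.le
      have h5 : (t : ℝ) ^ (-1 - b) = (t : ℝ) ^ (-b) / t := by
        rw [show -1 - b = -b - 1 by ring, Real.rpow_sub_one ht0.ne']
      have h6 : c * (t : ℝ) ^ (-1 - b) ≤ C * ((t : ℝ) ^ (-b) / t) := by
        rw [h5]
        exact mul_le_mul_of_nonneg_right ((by linarith : c ≤ c + 1).trans (le_max_right _ _))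
          (by positivity)
      have h7 : (1 - 2 / (t : ℝ)) * (C * (t : ℝ) ^ (-b)) + C * ((t : ℝ) ^ (-b) / t) ≤
          C * ((t : ℝ) ^ (-b) * (1 - b / t)) := by
        have : C * ((t : ℝ) ^ (-b) * (1 - b / t)) -
            ((1 - 2 / (t : ℝ)) * (C * (t : ℝ) ^ (-b)) + C * ((t : ℝ) ^ (-b) / t)) =
            (1 - b) * (C * (t : ℝ) ^ (-b) / t) := by ring
        have h8 : 0 ≤ (1 - b) * (C * (t : ℝ) ^ (-b) / t) :=
          mul_nonneg (by linarith) (by positivity)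
        linarith
      push_cast
      linarith
  have hT0 : (0 : ℝ) < T := by exact_mod_cast (by omega : 0 < T)
  have hfin : ∀ n : ℕ, 1 - (C + 4 * c / b) / η * (T : ℝ) ^ (-b) ≤
      μ.real {ω | ∀ j < n, D (T + j) ω ≤ η} := by
    intro n
    have h1 := le_measureReal_forall_lt (η := η) hb hb1 hc ht₁ hD hD0 hint hstep hT n
    have h2 : 0 ≤ ∫ ω in {ω | ∀ j < n, D (T + j) ω ≤ η}, D (T + n) ω ∂μ :=
      integral_nonneg (hD0 _ (by omega))
    have h3 : (0 : ℝ) ≤ ((T + n : ℕ) : ℝ) ^ (-b) := by positivity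
    have h4 := hmean T hT
    have h5 : 4 * c / b * ((T : ℝ) ^ (-b) - ((T + n : ℕ) : ℝ) ^ (-b)) ≤
        4 * c / b * (T : ℝ) ^ (-b) :=
      mul_le_mul_of_nonneg_left (by linarith) (by positivity)
    have h6 : 1 - μ.real {ω | ∀ j < n, D (T + j) ω ≤ η} ≤
        (C + 4 * c / b) * (T : ℝ) ^ (-b) / η := by
      rw [le_div_iff₀' hη]
      linarith
    rw [div_mul_eq_mul_div]
    linarith
  have hset : {ω | ∀ t, T ≤ t → D t ω ≤ η} = ⋂ n : ℕ, {ω | ∀ j < n, D (T + j) ω ≤ η} := by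
    ext ω
    simp only [Set.mem_ofPred_eq, Set.mem_iInter]
    refine ⟨fun h n j _ => h (T + j) (by omega), fun h t ht => ?_⟩
    have := h (t - T + 1) (t - T) (by omega)
    rwa [Nat.add_sub_cancel' ht] at this
  have hlim : Tendsto (fun n : ℕ => μ.real {ω | ∀ j < n, D (T + j) ω ≤ η}) atTop
      (𝓝 (μ.real {ω | ∀ t, T ≤ t → D t ω ≤ η})) := by
    rw [hset]
    refine (ENNReal.tendsto_toReal (measure_ne_top _ _)).comp
      (tendsto_measure_iInter_atTop (fun n => ?_) (fun n k hnk ω hω j hj => hω j (by omega))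
        ⟨0, measure_ne_top _ _⟩)
    exact (ℱ.le _ _ (measurableSet_forall_lt hD T n (k := T + n) (by omega))).nullMeasurableSet
  exact ge_of_tendsto' hlim hfin

/-! ### Combination of the two timescales -/

lemma stepSize_of_pos {a₀ p : ℝ} {t : ℕ} (ht : 1 ≤ t) :
    stepSize a₀ p t = a₀ * (t : ℝ) ^ (-p) := if_neg (by omega)

/-- The algebra behind the combination of the two Lyapunov functions; `τ` is `1 / t`. -/
lemma combined_step {z z' y y' qq u w w' v v' ka kd τ α₀ β₀ r c r' c' A : ℝ}
    (hα₀ : 0 < α₀) (hβ₀ : 0 < β₀) (hr : 0 < r) (hc : 0 ≤ c) (hc' : 0 ≤ c')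
    (hA : 8 * c * α₀ ≤ A * (r' * β₀)) (hA0 : 0 ≤ A) (hr' : 0 < r')
    (hz : 0 ≤ z) (hy : 0 ≤ y) (hz' : 0 ≤ z') (hy' : 0 ≤ y') (hu : 0 ≤ u) (hw : 0 ≤ w) (hv : 0 ≤ v)
    (hka : 0 ≤ ka) (hkd : 0 ≤ kd) (hkdka : kd ≤ ka) (hτ : 0 ≤ τ) (hτ1 : τ ≤ 1)
    (hwv : w * ka = v * kd) (hww' : w' ≤ (1 + τ) * w) (hvv' : v' ≤ (1 + τ) * v)
    (hrτ : 3 * τ ≤ r * α₀ * ka) (hrτ' : 3 * τ ≤ r' * β₀ / 2 * kd)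
    (h1 : z' ≤ (1 - r * (α₀ * ka)) * z + c * (α₀ * ka) * qq + c * (α₀ * ka) ^ 2 * u)
    (h2 : y' ≤ (1 - r' * (β₀ * kd)) * y + c' * (β₀ * kd) ^ 2 * u) (h3 : qq ≤ 2 * y) :
    w' * z' + A * (v' * y') ≤ (1 - 2 * τ) * (w * z + A * (v * y)) +
      (2 * c * α₀ ^ 2 + 2 * A * c' * β₀ ^ 2) * (w * ka ^ 2) * u := by
  have a1 : w' * z' ≤ (1 + τ) * w * z' := mul_le_mul_of_nonneg_right hww' hz'
  have a2 : v' * y' ≤ (1 + τ) * v * y' := mul_le_mul_of_nonneg_right hvv' hy'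
  have b1 := mul_le_mul_of_nonneg_left h1 (by positivity : 0 ≤ (1 + τ) * w)
  have b2 := mul_le_mul_of_nonneg_left h2 (by positivity : 0 ≤ (1 + τ) * v)
  have c1 : (1 + τ) * w * ((1 - r * (α₀ * ka)) * z) ≤ (1 - 2 * τ) * (w * z) := by
    have : (1 + τ) * (1 - r * (α₀ * ka)) ≤ 1 - 2 * τ := by
      have : 0 ≤ τ * (r * (α₀ * ka)) := by positivity
      linarith
    have := mul_le_mul_of_nonneg_right this (mul_nonneg hw hz)
    linarith
  -- The identity `w * ka = v * kd` matches the coupling with the contraction of `y`, half of which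
  -- pays for it.
  have c2 : (1 + τ) * w * (c * (α₀ * ka) * qq) ≤ A * (r' * β₀ / 2 * kd * (v * y)) := by
    calc (1 + τ) * w * (c * (α₀ * ka) * qq) ≤ (1 + τ) * w * (c * (α₀ * ka) * (2 * y)) := by gcongr
      _ ≤ 2 * w * (c * (α₀ * ka) * (2 * y)) := by
        gcongr
        linarith
      _ = 4 * c * α₀ * (w * ka) * y := by ring
      _ = 8 * c * α₀ * (v * kd * y / 2) := by rw [hwv]; ring
      _ ≤ A * (r' * β₀) * (v * kd * y / 2) := by gcongr
      _ = _ := by ring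
  have c3 : (1 + τ) * v * ((1 - r' * (β₀ * kd)) * y) + r' * β₀ / 2 * kd * (v * y) ≤
      (1 - 2 * τ) * (v * y) := by
    have : (1 + τ) * (1 - r' * (β₀ * kd)) + r' * β₀ / 2 * kd ≤ 1 - 2 * τ := by
      have : 0 ≤ τ * (r' * (β₀ * kd)) := by positivity
      linarith
    have := mul_le_mul_of_nonneg_right this (mul_nonneg hv hy)
    linarith
  have c3' := mul_le_mul_of_nonneg_left c3 hA0
  have d1 : (1 + τ) * w * (c * (α₀ * ka) ^ 2 * u) ≤ 2 * c * α₀ ^ 2 * (w * ka ^ 2) * u := by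
    calc _ ≤ 2 * w * (c * (α₀ * ka) ^ 2 * u) := by gcongr; linarith
      _ = _ := by ring
  have d2 : (1 + τ) * v * (c' * (β₀ * kd) ^ 2 * u) ≤ 2 * c' * β₀ ^ 2 * (w * ka ^ 2) * u := by
    calc _ ≤ 2 * v * (c' * (β₀ * kd) ^ 2 * u) := by gcongr; linarith
      _ = 2 * c' * β₀ ^ 2 * (v * kd * kd) * u := by ring
      _ ≤ 2 * c' * β₀ ^ 2 * (v * kd * ka) * u := by gcongr
      _ = _ := by rw [← hwv]; ring
  have d2' := mul_le_mul_of_nonneg_left d2 hA0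
  have a2' := mul_le_mul_of_nonneg_left (a2.trans b2) hA0
  have a1' := a1.trans b1
  linarith

section Rate

variable {m : ℕ} {S : Set (Vec m)} {V : S → ℝ}

/-- Stated for abstract Lyapunov processes so that it serves both iterates. The weight `t^(2κc)`
turns the shrinking target into a fixed level. -/
theorem exists_rate {α₀ β₀ r c r' c' U κ δ κc C : ℝ} (hα₀ : 0 < α₀)
    (hβ₀ : 0 < β₀) (hr : 0 < r) (hc : 0 < c) (hr' : 0 < r') (hc' : 0 < c') (hU : 0 ≤ U)
    (hκ : 1 / 2 < κ) (hκδ : κ ≤ δ) (hδ : δ < 1) (hκc : 0 ≤ κc) (hκcκ : κc < κ - 1 / 2)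
    (hC : 0 < C) :
    ∃ K : ℝ, 0 < K ∧ ∃ T₀ : ℕ, ∀ {Ω : Type*} [mΩ : MeasurableSpace Ω] (μ : Measure Ω)
      [IsProbabilityMeasure μ] (ℱ : Filtration ℕ mΩ) (W : ℕ → Ω → S) (n q Z Y : ℕ → Ω → ℝ),
      (∀ t, Integrable (fun ω => V (W t ω) ^ 2) μ) →
      (∀ t, ∫ ω, V (W t ω) ^ 2 ∂μ ≤ U) → (∀ t, 1 ≤ t → Integrable (fun ω => q t ω ^ 2) μ) →
      IsLyapunovProcess μ V r c (stepSize α₀ κ) ℱ W n q Z →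
      IsLyapunovProcess μ V r' c' (stepSize β₀ δ) ℱ W q (fun _ _ => 0) Y →
      ∀ T : ℕ, T₀ ≤ T → 1 - K * (T : ℝ) ^ (-(2 * κ - 1 - 2 * κc)) ≤
        μ.real {ω | ∀ t, T ≤ t → n t ω ≤ C * (t : ℝ) ^ (-κc)} := by
  set b : ℝ := 2 * κ - 1 - 2 * κc with hb
  have hb0 : 0 < b := by rw [hb]; linarith
  have hb1 : b ≤ 1 := by rw [hb]; linarith
  set A : ℝ := 8 * c * α₀ / (r' * β₀) with hA
  have hA0 : 0 ≤ A := by positivity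
  have hAmul : 8 * c * α₀ ≤ A * (r' * β₀) := by rw [hA, div_mul_cancel₀ _ (by positivity)]
  set N : ℝ := (2 * c * α₀ ^ 2 + 2 * A * c' * β₀ ^ 2) * U with hN
  have hN0 : 0 ≤ N := by positivity
  set s : ℝ := 2 * κc with hs
  -- The exponent for which `s' - δ = s - κ`.
  set s' : ℝ := s + (δ - κ) with hs'
  -- Since `κ, δ < 1`, the step sizes eventually dominate `3 / t`: one unit pays for the growth of
  -- the weights, two remain as contraction.
  obtain ⟨t₁, ht₁⟩ := eventually_atTop.1 ((eventually_div_le_mul_rpow_neg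
    (mul_pos hr hα₀) (hκδ.trans_lt hδ) 3).and ((eventually_div_le_mul_rpow_neg
    (by positivity : 0 < r' * β₀ / 2) hδ 3).and (eventually_ge_atTop 2)))
  have ht₁2 : 2 ≤ t₁ := (ht₁ t₁ le_rfl).2.2
  -- The level is `C² / 2` because `Z` dominates only `n² / 2`.
  obtain ⟨K, hK, htail⟩ := exists_tail_bound hb0 hb1 hN0 (by positivity : 0 < C ^ 2 / 2) ht₁2
    ((t₁ : ℝ) ^ s * (c * U) + A * ((t₁ : ℝ) ^ s' * (c' * U)))
  refine ⟨K, hK, t₁, fun {Ω} mΩ μ _ ℱ W n q Z Y hUint hUle hq hZ hY T hT => ?_⟩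
  obtain ⟨D, hD⟩ : ∃ D : ℕ → Ω → ℝ, ∀ t ω,
    D t ω = (t : ℝ) ^ s * Z t ω + A * ((t : ℝ) ^ s' * Y t ω) := ⟨_, fun _ _ => rfl⟩
  have hDfun : ∀ t, D t = fun ω => (t : ℝ) ^ s * Z t ω + A * ((t : ℝ) ^ s' * Y t ω) :=
    fun t => funext (hD t)
  have hZ0 : ∀ t, 1 ≤ t → ∀ ω, 0 ≤ Z t ω := fun t ht ω =>
    (by positivity : 0 ≤ n t ω ^ 2 / 2).trans (hZ.lower t ω ht)
  have hY0 : ∀ t, 1 ≤ t → ∀ ω, 0 ≤ Y t ω := fun t ht ω =>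
    (by positivity : 0 ≤ q t ω ^ 2 / 2).trans (hY.lower t ω ht)
  have hZint : ∀ t, 1 ≤ t → Integrable (Z t) μ := fun t ht =>
    ((hUint t).const_mul c).mono' ((hZ.measurable t).mono (ℱ.le t) le_rfl).aestronglyMeasurable
      (ae_of_all _ fun ω => by
        rw [Real.norm_of_nonneg (hZ0 t ht ω)]; exact hZ.upper t ω ht)
  have hYint : ∀ t, 1 ≤ t → Integrable (Y t) μ := fun t ht =>
    ((hUint t).const_mul c').mono' ((hY.measurable t).mono (ℱ.le t) le_rfl).aestronglyMeasurable
      (ae_of_all _ fun ω => by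
        rw [Real.norm_of_nonneg (hY0 t ht ω)]; exact hY.upper t ω ht)
  have hDint : ∀ t, 1 ≤ t → ∀ E, ∫ ω in E, D t ω ∂μ =
      (t : ℝ) ^ s * ∫ ω in E, Z t ω ∂μ + A * ((t : ℝ) ^ s' * ∫ ω in E, Y t ω ∂μ) := by
    intro t ht E
    simp only [hD]
    rw [integral_add ((hZint t ht).integrableOn.const_mul _)
      (((hYint t ht).integrableOn.const_mul _).const_mul _), integral_const_mul,
      integral_const_mul, integral_const_mul]
  have hbound := htail μ ℱ D (fun t => by
      rw [hDfun]
      exact ((hZ.measurable t).const_mul _).add (((hY.measurable t).const_mul _).const_mul _))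
    (fun t ht ω => by
      have := hZ0 t (by omega) ω
      have := hY0 t (by omega) ω
      rw [hD]; positivity)
    (fun t ht => by
      rw [hDfun]
      exact ((hZint t (by omega)).const_mul _).add
        (((hYint t (by omega)).const_mul _).const_mul _)) ?_ ?_ T hT
  · refine hbound.trans (measureReal_mono fun ω hω t ht => ?_)
    have ht1 : 1 ≤ t := by omega
    have htpos : (0 : ℝ) < t := by exact_mod_cast ht1
    have h1 := hω t ht
    rw [hD] at h1
    have h2 : 0 ≤ A * ((t : ℝ) ^ s' * Y t ω) := by
      have := hY0 t ht1 ω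
      positivity
    have h3 := mul_le_mul_of_nonneg_left (hZ.lower t ω ht1) (by positivity : 0 ≤ (t : ℝ) ^ s)
    have h4 : (t : ℝ) ^ s = ((t : ℝ) ^ κc) ^ 2 := by
      rw [hs, mul_comm, Real.rpow_mul htpos.le, Real.rpow_two]
    rw [h4] at h1 h3
    rw [Real.rpow_neg htpos.le, ← div_eq_mul_inv, le_div_iff₀ (by positivity)]
    refine le_of_sq_le_sq ?_ hC.le
    nlinarith
  · have h1 := hDint t₁ (by omega) Set.univ
    simp only [Measure.restrict_univ] at h1
    rw [h1]
    have e1 : ∫ ω, Z t₁ ω ∂μ ≤ c * U := by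
      have := integral_mono (hZint t₁ (by omega)) ((hUint t₁).const_mul c)
        fun ω => hZ.upper t₁ ω (by omega)
      rw [integral_const_mul] at this
      exact this.trans (mul_le_mul_of_nonneg_left (hUle t₁) hc.le)
    have e2 : ∫ ω, Y t₁ ω ∂μ ≤ c' * U := by
      have := integral_mono (hYint t₁ (by omega)) ((hUint t₁).const_mul c')
        fun ω => hY.upper t₁ ω (by omega)
      rw [integral_const_mul] at this
      exact this.trans (mul_le_mul_of_nonneg_left (hUle t₁) hc'.le)
    gcongr
  · intro t E ht hE
    obtain ⟨hα, hβ, ht2⟩ := ht₁ t ht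
    have ht1 : 1 ≤ t := by omega
    have ht1' : (1 : ℝ) ≤ t := by exact_mod_cast ht1
    have htpos : (0 : ℝ) < t := by linarith
    rw [hDint t ht1, hDint (t + 1) (by omega)]
    have h1 := hZ.step t E ht1 hE
    have h2 := hY.step t E ht1 hE
    rw [stepSize_of_pos ht1] at h1 h2
    have h3 : ∫ ω in E, q t ω ^ 2 ∂μ ≤ 2 * ∫ ω in E, Y t ω ∂μ := by
      rw [← integral_const_mul]
      refine integral_mono (hq t ht1).integrableOn ((hYint t ht1).integrableOn.const_mul 2) fun ω => ?_
      have := hY.lower t ω ht1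
      linarith
    have hu0 : 0 ≤ ∫ ω in E, V (W t ω) ^ 2 ∂μ := integral_nonneg fun ω => by positivity
    have huU : ∫ ω in E, V (W t ω) ^ 2 ∂μ ≤ U :=
      (setIntegral_le_integral (hUint t) (ae_of_all _ fun ω => by positivity)).trans (hUle t)
    have hcomb := combined_step (w := (t : ℝ) ^ s) (w' := ((t + 1 : ℕ) : ℝ) ^ s)
      (v := (t : ℝ) ^ s') (v' := ((t + 1 : ℕ) : ℝ) ^ s') (τ := (t : ℝ)⁻¹) hα₀ hβ₀ hr hc.le hc'.le
      hAmul hA0 hr' (integral_nonneg (hZ0 t ht1)) (integral_nonneg (hY0 t ht1))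
      (integral_nonneg (hZ0 (t + 1) (by omega))) (integral_nonneg (hY0 (t + 1) (by omega)))
      hu0 (by positivity) (by positivity) (by positivity : 0 ≤ (t : ℝ) ^ (-κ))
      (by positivity : 0 ≤ (t : ℝ) ^ (-δ))
      (Real.rpow_le_rpow_of_exponent_le ht1' (by linarith)) (by positivity)
      (inv_le_one_of_one_le₀ ht1')
      (by rw [← Real.rpow_add htpos, ← Real.rpow_add htpos]; congr 1; rw [hs']; ring)
      (by push_cast; exact add_one_rpow_le (by rw [hs]; linarith) htpos)
      (by push_cast; exact add_one_rpow_le (by rw [hs', hs]; linarith) htpos)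
      (by rwa [div_eq_mul_inv] at hα) (by rwa [div_eq_mul_inv] at hβ) h1
      (by simpa using h2) h3
    refine hcomb.trans ?_
    rw [div_eq_mul_inv]
    have hpow : (t : ℝ) ^ s * ((t : ℝ) ^ (-κ)) ^ 2 = (t : ℝ) ^ (-1 - b) := by
      rw [← Real.rpow_natCast, ← Real.rpow_mul htpos.le, ← Real.rpow_add htpos]
      congr 1
      rw [hs, hb]; push_cast; ring
    rw [hpow, hN]
    have : 0 ≤ (t : ℝ) ^ (-1 - b) * (2 * c * α₀ ^ 2 + 2 * A * c' * β₀ ^ 2) := by positivity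
    have := mul_le_mul_of_nonneg_left huU this
    linarith

end Rate

/-! ### Step sizes -/

section StepSize

variable {a₀ p : ℝ}

lemma stepSize_nonneg (ha₀ : 0 < a₀) (t : ℕ) : 0 ≤ stepSize a₀ p t := by
  unfold stepSize
  split_ifs <;> positivity

lemma stepSize_le (ha₀ : 0 < a₀) (hp : 0 ≤ p) (t : ℕ) : stepSize a₀ p t ≤ a₀ := by
  rcases Nat.eq_zero_or_pos t with rfl | ht
  · simp [stepSize]
  · rw [stepSize_of_pos ht]
    have : (t : ℝ) ^ (-p) ≤ 1 :=
      Real.rpow_le_one_of_one_le_of_nonpos (by exact_mod_cast ht) (by linarith)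
    nlinarith

lemma stepSize_succ_le (ha₀ : 0 < a₀) (hp : 0 ≤ p) (t : ℕ) :
    stepSize a₀ p (t + 1) ≤ stepSize a₀ p t := by
  rcases Nat.eq_zero_or_pos t with rfl | ht
  · simp [stepSize]
  · rw [stepSize_of_pos ht, stepSize_of_pos (by omega)]
    refine mul_le_mul_of_nonneg_left ?_ ha₀.le
    exact Real.rpow_le_rpow_of_nonpos (by exact_mod_cast ht) (by push_cast; linarith)
      (by linarith)

/-- The increment is of order `t^(-p-1)`, which is at most `t^(-2p)` because `p ≤ 1`. Thus the
corrector's changing coefficient costs no more than the other second-order errors. -/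
lemma stepSize_sub_succ_le (ha₀ : 0 < a₀) (hp : 0 ≤ p) (hp1 : p ≤ 1) {t : ℕ} (ht : 1 ≤ t) :
    stepSize a₀ p t - stepSize a₀ p (t + 1) ≤ a₀⁻¹ * stepSize a₀ p t ^ 2 := by
  rw [stepSize_of_pos ht, stepSize_of_pos (by omega)]
  have ht1 : (1 : ℝ) ≤ t := by exact_mod_cast ht
  have ht0 : (0 : ℝ) < t := by linarith
  have h1 := mul_le_mul_of_nonneg_left (rpow_neg_add_one_ge hp hp1 ht1) ha₀.le
  have h2 : (t : ℝ) ^ (-p) * (p / t) ≤ ((t : ℝ) ^ (-p)) ^ 2 := by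
    have e1 : p / t ≤ (t : ℝ)⁻¹ := by
      rw [div_eq_mul_inv]; exact mul_le_of_le_one_left (by positivity) hp1
    have e2 : (t : ℝ)⁻¹ ≤ (t : ℝ) ^ (-p) := by
      rw [← Real.rpow_neg_one]
      exact Real.rpow_le_rpow_of_exponent_le ht1 (by linarith)
    rw [pow_two]
    exact mul_le_mul_of_nonneg_left (e1.trans e2) (by positivity)
  have h3 : a₀⁻¹ * (a₀ * (t : ℝ) ^ (-p)) ^ 2 = a₀ * ((t : ℝ) ^ (-p)) ^ 2 := by field_simp
  rw [h3]
  have h4 := mul_le_mul_of_nonneg_left h2 ha₀.le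
  push_cast
  linarith

end StepSize

/-- A polynomial bound holds a fortiori with an additional factor `log T`, once `T ≥ 3`. -/
lemma sub_mul_log_le {K x T y : ℝ} (hK : 0 ≤ K) (hx : 0 ≤ x) (hT : 3 ≤ T) (h : 1 - K * x ≤ y) :
    1 - K * x * Real.log T ≤ y := by
  have h1 : 1 ≤ Real.log T := by
    rw [Real.le_log_iff_exp_le (by linarith)]
    linarith [Real.exp_one_lt_d9]
  have : 0 ≤ K * x := mul_nonneg hK hx
  nlinarith

/-! ### The Lyapunov function and the concrete iterates -/

section Lyapunov

variable {m : ℕ} {S : Set (Vec m)}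

lemma measurable_lyapunov {dU : ℝ} : Measurable (lyapunov dU : S → ℝ) :=
  ((measurable_subtype_coe.norm).pow_const dU).const_add 1

lemma one_le_lyapunov {dU : ℝ} (w : S) : 1 ≤ lyapunov dU w :=
  le_add_of_nonneg_right (by positivity)

lemma one_add_norm_le (w : S) : 1 + ‖(w : Vec m)‖ ≤ 2 * √(lyapunov 2 w) := by
  have h : lyapunov 2 w = 1 + ‖(w : Vec m)‖ ^ 2 := by rw [lyapunov, Real.rpow_two]
  have h1 := Real.sq_sqrt (zero_le_one.trans (one_le_lyapunov (dU := 2) w))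
  have h2 := Real.sqrt_nonneg (lyapunov 2 w)
  refine le_of_sq_le_sq ?_ (by positivity)
  rw [mul_pow, h1, h]
  nlinarith [sq_nonneg (1 - ‖(w : Vec m)‖)]

end Lyapunov

section Trajectory

variable {m dl dx : ℕ} {S : Set (Vec m)} {P : Kernel S S} [IsMarkovKernel P] {w : S}
  {Ω : Type*} [mΩ : MeasurableSpace Ω] {μ : Measure Ω} [IsProbabilityMeasure μ]
  {ℱ : Filtration ℕ mΩ} {W : ℕ → Ω → S} {G : S → Vec dl → Vec dx → Vec dl}
  {H : S → Vec dx → Vec dx} {B : ℝ} {a b : ℕ → ℝ} {lam : ℕ → Ω → Vec dl} {xi : ℕ → Ω → Vec dx}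

namespace IsTwoTimescale

lemma measurable_xi (h : IsTwoTimescale G H B a b ℱ W lam xi) (hB : 0 < B)
    (hW : IsMarkovChainFrom P w μ ℱ W) (hH : Measurable fun q : S × Vec dx => H q.1 q.2) (t : ℕ) :
    Measurable[ℱ t] (xi t) := by
  induction t with
  | zero => exact h.xi_zero
  | succ t ih =>
    have h1 : Measurable fun q : S × Vec dx => ballProj B (q.2 + b t • H q.1 q.2) :=
      (continuous_ballProj hB).measurable.comp (measurable_snd.add (hH.const_smul (b t)))
    have h2 := h1.comp ((hW.adapted t).prodMk ih)
    rw [show xi (t + 1) = _ from funext (h.xi_succ t)]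
    exact h2.mono (ℱ.mono (Nat.le_succ t)) le_rfl

lemma measurable_lam (h : IsTwoTimescale G H B a b ℱ W lam xi) (hB : 0 < B)
    (hW : IsMarkovChainFrom P w μ ℱ W)
    (hG : Measurable fun q : S × Vec dl × Vec dx => G q.1 q.2.1 q.2.2)
    (hH : Measurable fun q : S × Vec dx => H q.1 q.2) (t : ℕ) :
    Measurable[ℱ t] (lam t) := by
  induction t with
  | zero => exact h.lam_zero
  | succ t ih =>
    have h1 : Measurable fun q : S × Vec dl × Vec dx =>
        ballProj B (q.2.1 + a t • G q.1 q.2.1 q.2.2) :=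
      (continuous_ballProj hB).measurable.comp
        ((measurable_fst.comp measurable_snd).add (hG.const_smul (a t)))
    have h2 := h1.comp ((hW.adapted t).prodMk (ih.prodMk (h.measurable_xi hB hW hH t)))
    rw [show lam (t + 1) = _ from funext (h.lam_succ t)]
    exact h2.mono (ℱ.mono (Nat.le_succ t)) le_rfl

lemma norm_xi_le (h : IsTwoTimescale G H B a b ℱ W lam xi) (hB : 0 < B) (t : ℕ) (ω : Ω)
    (ht : 1 ≤ t) : ‖xi t ω‖ ≤ B := by
  obtain ⟨t, rfl⟩ := Nat.exists_eq_add_of_le' ht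
  rw [h.xi_succ]
  exact norm_ballProj_le hB _

lemma norm_lam_le (h : IsTwoTimescale G H B a b ℱ W lam xi) (hB : 0 < B) (t : ℕ) (ω : Ω)
    (ht : 1 ≤ t) : ‖lam t ω‖ ≤ B := by
  obtain ⟨t, rfl⟩ := Nat.exists_eq_add_of_le' ht
  rw [h.lam_succ]
  exact norm_ballProj_le hB _

/-- The slow component is an autonomous recursion, with a trivial parameter. -/
lemma isDrivenBy_xi (h : IsTwoTimescale G H B a b ℱ W lam xi) (hB : 0 < B)
    (hW : IsMarkovChainFrom P w μ ℱ W) (hH : Measurable fun q : S × Vec dx => H q.1 q.2)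
    (V : S → ℝ) :
    IsDrivenBy (fun w x (_ : Vec 0) => H w x) V B 0 b ℱ W xi (fun _ _ => 0) where
  measurable_x := h.measurable_xi hB hW hH
  measurable_p _ := measurable_const
  succ := h.xi_succ
  norm_x := h.norm_xi_le hB
  norm_p _ _ _ := by simpa using hB.le
  p_succ _ _ _ := by simp

/-- Here `xi` is the parameter of `lam`; it moves by at most `O(a_t V)` per step because its step
size is at most a multiple of `a_t`. -/
lemma isDrivenBy_lam (h : IsTwoTimescale G H B a b ℱ W lam xi) (hB : 0 < B)
    (hW : IsMarkovChainFrom P w μ ℱ W)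
    (hG : Measurable fun q : S × Vec dl × Vec dx => G q.1 q.2.1 q.2.2)
    (hH : Measurable fun q : S × Vec dx => H q.1 q.2) {V : S → ℝ} (hV : ∀ w, 0 ≤ V w) {L c : ℝ}
    (hL : 0 ≤ L) (hHb : ∀ w x, ‖x‖ ≤ B → ‖H w x‖ ≤ L * V w) (hb : ∀ t, 0 ≤ b t)
    (hba : ∀ t, 1 ≤ t → b t ≤ c * a t) :
    IsDrivenBy G V B (L * c) a ℱ W lam xi where
  measurable_x := h.measurable_lam hB hW hG hH
  measurable_p := h.measurable_xi hB hW hH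
  succ := h.lam_succ
  norm_x := h.norm_lam_le hB
  norm_p := h.norm_xi_le hB
  p_succ t ω ht := by
    have hx := h.norm_xi_le hB t ω ht
    rw [h.xi_succ]
    refine (norm_ballProj_sub_le_of_norm_le hB _ hx).trans ?_
    rw [add_sub_cancel_left, norm_smul, Real.norm_of_nonneg (hb t)]
    calc b t * ‖H (W t ω) (xi t ω)‖ ≤ b t * (L * V (W t ω)) :=
          mul_le_mul_of_nonneg_left (hHb _ _ hx) (hb t)
      _ ≤ c * a t * (L * V (W t ω)) :=
          mul_le_mul_of_nonneg_right (hba t ht) (mul_nonneg hL (hV _))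
      _ = _ := by ring

lemma integrable_xi_sub_sq (h : IsTwoTimescale G H B a b ℱ W lam xi) (hB : 0 < B)
    (hW : IsMarkovChainFrom P w μ ℱ W) (hH : Measurable fun q : S × Vec dx => H q.1 q.2)
    {x₀ : Vec dx} (t : ℕ) (ht : 1 ≤ t) : Integrable (fun ω => ‖xi t ω - x₀‖ ^ 2) μ := by
  have hm : Measurable (xi t) := (h.measurable_xi hB hW hH t).mono (ℱ.le t) le_rfl
  refine (integrable_const ((B + ‖x₀‖) ^ 2)).mono'
    (((hm.sub_const x₀).norm).pow_const 2).aestronglyMeasurable (ae_of_all _ fun ω => ?_)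
  rw [Real.norm_of_nonneg (by positivity)]
  have : ‖xi t ω - x₀‖ ≤ B + ‖x₀‖ :=
    (norm_sub_le _ _).trans (by gcongr; exact h.norm_xi_le hB t ω ht)
  gcongr

end IsTwoTimescale

end Trajectory

/-! ### From the regularity assumptions to Lipschitz monotone fields -/

namespace IsRegularSystem

variable {m dl dx : ℕ} {S : Set (Vec m)} {ν : Measure S} [IsProbabilityMeasure ν]
  {G : S → Vec dl → Vec dx → Vec dl} {H : S → Vec dx → Vec dx} {B : ℝ} {lamStar : Vec dl}
  {xiStar : Vec dx}

lemma exists_isLipschitzField (h : IsRegularSystem ν G H B lamStar xiStar)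
    (hG : Measurable fun q : S × Vec dl × Vec dx => G q.1 q.2.1 q.2.2)
    (hH : Measurable fun q : S × Vec dx => H q.1 q.2) :
    ∃ L : ℝ, IsLipschitzField (fun w => √(lyapunov 2 w)) B L G ∧
      IsLipschitzField (fun w => √(lyapunov 2 w)) B L (fun w x (_ : Vec 0) => H w x) := by
  obtain ⟨L, hL, ⟨hf, hf0, hfL, hGlip, hHlip⟩, hGb, hHb⟩ := h.lipschitz_growth
  have hV : ∀ w : S, L * (1 + ‖(w : Vec m)‖) ≤ 2 * L * √(lyapunov 2 w) := fun w => by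
    have := mul_le_mul_of_nonneg_left (one_add_norm_le w) hL.le
    linarith
  refine ⟨2 * L, ⟨hG, by positivity, fun w x p hx hp => (hGb w x p hx hp).trans (hV w),
    fun w x p x' p' hx hp hx' hp' => (hGlip w x x' p p' hx hx' hp hp').trans ?_⟩,
    ⟨hH.comp (measurable_fst.prodMk (measurable_fst.comp measurable_snd)), by positivity,
    fun w x p hx hp => (hHb w x hx).trans (hV w),
    fun w x p x' p' hx hp hx' hp' => (hHlip w x x' hx hx').trans ?_⟩⟩
  · exact mul_le_mul_of_nonneg_right ((hfL w).trans (hV w)) (by positivity)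
  · refine mul_le_mul ((hfL w).trans (hV w)) (le_add_of_nonneg_right (norm_nonneg _))
      (norm_nonneg _) (by positivity)

lemma exists_monotone_G (h : IsRegularSystem ν G H B lamStar xiStar)
    (hint : ∀ x, ‖x‖ ≤ B → Integrable (fun w => G w x xiStar) ν) :
    ∃ ζ : ℝ, 0 < ζ ∧ ∀ x, ‖x‖ ≤ B →
      ∫ w, inner ℝ (x - lamStar) (G w x xiStar) ∂ν ≤ -ζ * ‖x - lamStar‖ ^ 2 := by
  obtain ⟨ζ, hζ, hmono⟩ := h.monotone_G
  refine ⟨ζ, hζ, fun x hx => ?_⟩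
  have h0 : meanG ν G lamStar xiStar = 0 := (h.root_G lamStar).2 rfl
  have := hmono x
  rw [h0, sub_zero] at this
  rwa [integral_inner (hint x hx)]

lemma exists_monotone_H (h : IsRegularSystem ν G H B lamStar xiStar)
    (hint : ∀ x, ‖x‖ ≤ B → Integrable (fun w => H w x) ν) :
    ∃ ψ : ℝ, 0 < ψ ∧ ∀ x, ‖x‖ ≤ B →
      ∫ w, inner ℝ (x - xiStar) (H w x) ∂ν ≤ -ψ * ‖x - xiStar‖ ^ 2 := by
  obtain ⟨ζ, hζ, hmono⟩ := h.monotone_H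
  refine ⟨ζ, hζ, fun x hx => ?_⟩
  have h0 : meanH ν H xiStar = 0 := (h.root_H xiStar).2 rfl
  have := hmono x
  rw [h0, sub_zero] at this
  rwa [integral_inner (hint x hx)]

end IsRegularSystem

end TwoTimescaleSA

/-! ### Assembly of the theorem -/

open TwoTimescaleSA

theorem theorem1
    {m dl dx : ℕ} {S : Set (TwoTimescaleSA.Vec m)} (hS : MeasurableSet S)
    (P : Kernel S S) [IsMarkovKernel P] (ν : Measure S)
    (G : S → TwoTimescaleSA.Vec dl → TwoTimescaleSA.Vec dx → TwoTimescaleSA.Vec dl)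
    (H : S → TwoTimescaleSA.Vec dx → TwoTimescaleSA.Vec dx)
    (hG : Measurable
      (fun p : S × TwoTimescaleSA.Vec dl × TwoTimescaleSA.Vec dx => G p.1 p.2.1 p.2.2))
    (hH : Measurable (fun p : S × TwoTimescaleSA.Vec dx => H p.1 p.2))
    (B : ℝ) (lamStar : TwoTimescaleSA.Vec dl) (xiStar : TwoTimescaleSA.Vec dx)
    (hErg : TwoTimescaleSA.IsGeometricallyErgodic P ν 2)
    (hSys : TwoTimescaleSA.IsRegularSystem ν G H B lamStar xiStar)
    (α₀ β₀ : ℝ) (hα₀ : 0 < α₀) (hβ₀ : 0 < β₀)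
    (C : ℝ) (hC : 0 < C) (w : S) :
    -- bounds for the trajectory of `lam`
    (∀ κ δ κc : ℝ, 1 / 2 < κ → κ ≤ δ → δ < 1 → 0 ≤ κc → κc < κ - 1 / 2 →
      ∃ Clam : ℝ, 0 < Clam ∧ ∃ T₀ : ℕ,
        ∀ (Ω : Type*) [mΩ : MeasurableSpace Ω] (μ : Measure Ω) [IsProbabilityMeasure μ]
          (ℱ : Filtration ℕ mΩ) (W : ℕ → Ω → S)
          (lam : ℕ → Ω → TwoTimescaleSA.Vec dl) (xi : ℕ → Ω → TwoTimescaleSA.Vec dx),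
          TwoTimescaleSA.IsMarkovChainFrom P w μ ℱ W →
          TwoTimescaleSA.IsTwoTimescale G H B (TwoTimescaleSA.stepSize α₀ κ)
            (TwoTimescaleSA.stepSize β₀ δ) ℱ W lam xi →
          ∀ T : ℕ, T₀ ≤ T →
            1 - Clam * (T : ℝ) ^ (-(2 * κ - 1 - 2 * κc)) * Real.log T ≤
              μ.real {ω | ∀ t : ℕ, T ≤ t → ‖lam t ω - lamStar‖ ≤ C * (t : ℝ) ^ (-κc)} ∧
            (TwoTimescaleSA.IsIID P ν →
              1 - Clam * (T : ℝ) ^ (-(2 * κ - 1 - 2 * κc)) ≤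
                μ.real {ω | ∀ t : ℕ, T ≤ t → ‖lam t ω - lamStar‖ ≤ C * (t : ℝ) ^ (-κc)})) ∧
    -- bounds for the trajectory of `xi`; the constant is chosen before `κ`
    (∀ δ δc : ℝ, 1 / 2 < δ → δ < 1 → 0 ≤ δc → δc < δ - 1 / 2 →
      ∃ Cxi : ℝ, 0 < Cxi ∧ ∀ κ : ℝ, 1 / 2 < κ → κ ≤ δ → ∃ T₀ : ℕ,
        ∀ (Ω : Type*) [mΩ : MeasurableSpace Ω] (μ : Measure Ω) [IsProbabilityMeasure μ]
          (ℱ : Filtration ℕ mΩ) (W : ℕ → Ω → S)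
          (lam : ℕ → Ω → TwoTimescaleSA.Vec dl) (xi : ℕ → Ω → TwoTimescaleSA.Vec dx),
          TwoTimescaleSA.IsMarkovChainFrom P w μ ℱ W →
          TwoTimescaleSA.IsTwoTimescale G H B (TwoTimescaleSA.stepSize α₀ κ)
            (TwoTimescaleSA.stepSize β₀ δ) ℱ W lam xi →
          ∀ T : ℕ, T₀ ≤ T →
            1 - Cxi * (T : ℝ) ^ (-(2 * δ - 1 - 2 * δc)) * Real.log T ≤
              μ.real {ω | ∀ t : ℕ, T ≤ t → ‖xi t ω - xiStar‖ ≤ C * (t : ℝ) ^ (-δc)} ∧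
            (TwoTimescaleSA.IsIID P ν →
              1 - Cxi * (T : ℝ) ^ (-(2 * δ - 1 - 2 * δc)) ≤
                μ.real {ω | ∀ t : ℕ, T ≤ t → ‖xi t ω - xiStar‖ ≤ C * (t : ℝ) ^ (-δc)})) := by
  have := hErg.isProbabilityMeasure
  obtain ⟨W₀, hW₀, ⟨N, -, b₁, hb₁, ψ, hψ, hmin⟩, ρ, hρ, hρ1, b₂, hb₂, hdrift⟩ :=
    hErg.minorization_drift
  have hdU' : HasDrift P (lyapunov 2) W₀ ρ b₂ :=
    hasDrift_of_lintegral_le measurable_lyapunov one_le_lyapunov hW₀ hρ hρ1 hb₂ hdrift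
  have hdV := hdU'.sqrt
  obtain ⟨V, hV⟩ : ∃ V : S → ℝ, V = fun w => √(lyapunov 2 w) := ⟨_, rfl⟩
  have hU : (fun w => V w ^ 2) = lyapunov 2 := by
    rw [hV]
    exact funext fun w => Real.sq_sqrt (zero_le_one.trans (one_le_lyapunov (dU := 2) w))
  rw [← hV] at hdV
  have hdU : HasDrift P (fun w => V w ^ 2) W₀ ρ b₂ := by rwa [hU]
  have hV0 : ∀ w, 0 ≤ V w := fun w => zero_le_one.trans (hdV.one_le w)
  have hνV := hdV.integrable_of_invariant hErg.invariant
  obtain ⟨cΓ, Γ, hΓ⟩ := hdV.exists_poissonSolver hb₁ hmin hErg.invariant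
  obtain ⟨L, hGf, hHf⟩ := hSys.exists_isLipschitzField hG hH
  rw [← hV] at hGf hHf
  have hL := hGf.nonneg
  have hB : 0 < B := ((norm_nonneg _).trans (le_max_left _ _)).trans_lt hSys.radius
  have hlB : ‖lamStar‖ ≤ B := (le_max_left _ _).trans hSys.radius.le
  have hxB : ‖xiStar‖ ≤ B := (le_max_right _ _).trans hSys.radius.le
  have h0B : ‖(0 : Vec 0)‖ ≤ B := by simpa using hB.le
  obtain ⟨ζ, hζ, hmonoG⟩ := hSys.exists_monotone_G fun x hx =>
    (hνV.const_mul L).mono' (hG.comp (measurable_id.prodMk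
      (measurable_const (a := (x, xiStar))))).aestronglyMeasurable
      (ae_of_all _ fun w => hGf.growth w x xiStar hx hxB)
  obtain ⟨ψH, hψH, hmonoH⟩ := hSys.exists_monotone_H fun x hx =>
    (hνV.const_mul L).mono' (hH.comp (measurable_id.prodMk
      (measurable_const (a := x)))).aestronglyMeasurable
      (ae_of_all _ fun w => hHf.growth w x 0 hx h0B)
  -- This uniform bound for `E[V (W_t)²]` is how the starting point `w` enters the constants.
  have hU0 : 0 ≤ V w ^ 2 + b₂ / (1 - ρ) :=
    add_nonneg (sq_nonneg _) (div_nonneg hb₂.le (by linarith))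
  refine ⟨fun κ δ κc hκ hκδ hδ hκc hκcκ => ?_, fun δ δc hδ hδ1 hδc hδcδ => ?_⟩
  · have hκ0 : 0 ≤ κ := by linarith
    have hκ1 : κ ≤ 1 := by linarith
    have hδ0 : 0 ≤ δ := by linarith
    have hba : ∀ t, 1 ≤ t → stepSize β₀ δ t ≤ β₀ / α₀ * stepSize α₀ κ t := fun t ht => by
      rw [stepSize_of_pos ht, stepSize_of_pos ht, ← mul_assoc, div_mul_cancel₀ _ hα₀.ne']
      exact mul_le_mul_of_nonneg_left (Real.rpow_le_rpow_of_exponent_le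
        (by exact_mod_cast ht) (by linarith)) hβ₀.le
    obtain ⟨r, c, hr, hc, hlyap⟩ := exists_lyapunovProcess hdV hdU hνV hΓ hB hGf hlB hxB hζ hmonoG
      (stepSize_nonneg hα₀) (stepSize_succ_le hα₀ hκ0) (stepSize_le hα₀ hκ0)
      (inv_nonneg.2 hα₀.le) (fun t ht => stepSize_sub_succ_le hα₀ hκ0 hκ1 ht)
      (by positivity : 0 ≤ L * (β₀ / α₀))
    obtain ⟨r', c', hr', hc', hlyap'⟩ := exists_lyapunovProcess hdV hdU hνV hΓ hB hHf hxB h0B hψH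
      hmonoH (stepSize_nonneg hβ₀) (stepSize_succ_le hβ₀ hδ0) (stepSize_le hβ₀ hδ0)
      (inv_nonneg.2 hβ₀.le) (fun t ht => stepSize_sub_succ_le hβ₀ hδ0 hδ.le ht) le_rfl
    obtain ⟨K, hK, T₀, hrate⟩ := exists_rate (V := V) hα₀ hβ₀ hr hc hr' hc' hU0 hκ hκδ hδ hκc hκcκ hC
    -- From `T = 3` on, `log T ≥ 1`, so the bound with the logarithm is the weaker one.
    refine ⟨K, hK, max T₀ 3, fun Ω mΩ μ _ ℱ W lam xi hW hsa T hT => ?_⟩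
    obtain ⟨Z, hZ⟩ := hlyap μ ℱ w W lam xi hW (hsa.isDrivenBy_lam hB hW hG hH hV0 hL
      (fun y x hx => hHf.growth y x 0 hx h0B) (stepSize_nonneg hβ₀) hba)
    obtain ⟨Y, hY⟩ := hlyap' μ ℱ w W xi _ hW (hsa.isDrivenBy_xi hB hW hH V)
    simp only [sub_self, norm_zero] at hY
    have hbound := hrate μ ℱ W _ _ Z Y (fun t => (hW.integrable_and_integral_le hdU t).1)
      (fun t => (hW.integrable_and_integral_le hdU t).2)
      (hsa.integrable_xi_sub_sq hB hW hH) hZ hY T (le_of_max_le_left hT)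
    exact ⟨sub_mul_log_le hK.le (by positivity) (by exact_mod_cast le_of_max_le_right hT) hbound,
      fun _ => hbound⟩
  · have hδ0 : 0 ≤ δ := by linarith
    obtain ⟨r, c, hr, hc, hlyap⟩ := exists_lyapunovProcess hdV hdU hνV hΓ hB hHf hxB h0B hψH
      hmonoH (stepSize_nonneg hβ₀) (stepSize_succ_le hβ₀ hδ0) (stepSize_le hβ₀ hδ0)
      (inv_nonneg.2 hβ₀.le) (fun t ht => stepSize_sub_succ_le hβ₀ hδ0 hδ1.le ht) le_rfl
    -- The rate is used with `κ = δ`, `α₀ = β₀` and a vanishing second process: `xi` is autonomous,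
    -- so its constant is found before `κ` is introduced.
    obtain ⟨K, hK, T₀, hrate⟩ := exists_rate (V := V) hβ₀ hβ₀ hr hc one_pos one_pos hU0 hδ le_rfl
      hδ1 hδc hδcδ hC
    refine ⟨K, hK, fun κ _ _ => ⟨max T₀ 3, fun Ω mΩ μ _ ℱ W lam xi hW hsa T hT => ?_⟩⟩
    obtain ⟨Z, hZ⟩ := hlyap μ ℱ w W xi _ hW (hsa.isDrivenBy_xi hB hW hH V)
    simp only [sub_self, norm_zero] at hZ
    have hzero : IsLyapunovProcess μ V 1 1 (stepSize β₀ δ) ℱ W (fun _ _ => 0) (fun _ _ => 0)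
        (fun _ _ => 0) :=
      { measurable := fun _ => measurable_const
        lower := fun _ _ _ => by simp
        upper := fun _ _ _ => by positivity
        step := fun _ _ _ _ => by
          simpa using mul_nonneg (sq_nonneg _) (integral_nonneg fun _ => sq_nonneg _) }
    have hbound := hrate μ ℱ W _ _ Z _ (fun t => (hW.integrable_and_integral_le hdU t).1)
      (fun t => (hW.integrable_and_integral_le hdU t).2) (by simp) hZ hzero T
      (le_of_max_le_left hT)
    exact ⟨sub_mul_log_le hK.le (by positivity) (by exact_mod_cast le_of_max_le_right hT) hbound,
      fun _ => hbound⟩
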